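/- Let $\mathfrak{S}_n$ be the set of permutations $\pi=\pi_1\pi_2\cdots\pi_n$ of $\{1,\dots,n\}$, and let $\mathrm{inv}(w)$ denote the number of inversions of a word $w=w_1\cdots w_m$, i.e. of pairs $i<j$ with $w_i>w_j$. For an integer $r\ge 1$ put $r\mathsf{Des}(\pi)=\{i : 1\le i\le n-1,\ \pi_i\ge \pi_{i+1}+r\}$, $r\mathsf{des}(\pi)=|r\mathsf{Des}(\pi)|$ and $$r\mathsf{maj}(\pi)=\sum_{i\in r\mathsf{Des}(\pi)} i+\bigl|\{(i,j) : i<j,\ \pi_j<\pi_i<\pi_j+r\}\bigr|.$$ For integers $g,\ell\ge 1$ put $g\mathsf{exc}_\ell(\pi)=|\{i : \pi_i\ge i+g,\ i\ge \ell\}|$ and $g\mathsf{Excp}_\ell(\pi)=\{i : \pi_i\ge i+g,\ \pi_i\ge \ell\}$. Let $g\mathsf{Exc}_\ell(\pi)$ be the subword of $\pi$ formed by the letters $\pi_i$ with $i\in g\mathsf{Excp}_\ell(\pi)$ and $g\mathsf{Nexc}_\ell(\pi)$ the subword formed by the remaining letters, both in their order in $\pi$, and put $$g\mathsf{den}_\ell(\pi)=\sum_{i\in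 g\mathsf{Excp}_\ell(\pi)}(i+g-1)+\mathrm{inv}(g\mathsf{Exc}_\ell(\pi))+\mathrm{inv}(g\mathsf{Nexc}_\ell(\pi)).$$ Theorem (conjectured by Liu). For all integers $g,\ell\ge 1$ the pair $(g\mathsf{exc}_\ell,g\mathsf{den}_\ell)$ is $r$-Euler-Mahonian with $r=g+\ell-1$; that is, for every $n$, as polynomials in $t$ and $q$, $$\sum_{\pi\in\mathfrak{S}_n}t^{\,g\mathsf{exc}_\ell(\pi)}q^{\,g\mathsf{den}_\ell(\pi)}=\sum_{\pi\in\mathfrak{S}_n}t^{\,r\mathsf{des}(\pi)}q^{\,r\mathsf{maj}(\pi)}.$$ -/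

import Mathlib

open Finset

/-- The place `i ∈ {1, …, n}` (counted from `1`) that the index `i : Fin n` stands for. -/
def place {n : ℕ} (i : Fin n) : ℕ := (i : ℕ) + 1

/-- The letter `π_i ∈ {1, …, n}` (counted from `1`) of the permutation `π = π₁ π₂ ⋯ πₙ`. -/
def letter {n : ℕ} (π : Equiv.Perm (Fin n)) (i : Fin n) : ℕ := (π i : ℕ) + 1

/-- The set of inversions of `π`: the pairs `(i, j)` with `i < j` and `π_i > π_j`. -/
def invSet {n : ℕ} (π : Equiv.Perm (Fin n)) : Finset (Fin n × Fin n) :=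
  univ.filter fun p => p.1 < p.2 ∧ letter π p.2 < letter π p.1

/-- The number of inversions of the subword of `π` formed by the letters in the places of `S`,
read from left to right. -/
def invOn {n : ℕ} (π : Equiv.Perm (Fin n)) (S : Finset (Fin n)) : ℕ :=
  #((invSet π).filter fun p => p.1 ∈ S ∧ p.2 ∈ S)

/-- The `r`-descent set: the places `i ∈ {1, …, n - 1}` with `π_i ≥ π_{i+1} + r`. -/
def rDes (r : ℕ) {n : ℕ} (π : Equiv.Perm (Fin n)) : Finset (Fin n) :=
  univ.filter fun i => ∃ j : Fin n, place j = place i + 1 ∧ letter π j + r ≤ letter π i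

/-- The `r`-inversion set: the inversions `(i, j)` with `π_i < π_j + r`. -/
def rInv (r : ℕ) {n : ℕ} (π : Equiv.Perm (Fin n)) : Finset (Fin n × Fin n) :=
  (invSet π).filter fun p => letter π p.1 < letter π p.2 + r

/-- The `r`-descent number. -/
def rdes (r : ℕ) {n : ℕ} (π : Equiv.Perm (Fin n)) : ℕ := #(rDes r π)

/-- The `r`-major index. -/
def rmaj (r : ℕ) {n : ℕ} (π : Equiv.Perm (Fin n)) : ℕ :=
  (∑ i ∈ rDes r π, place i) + #(rInv r π)

/-- The set of `g`-gap `ℓ`-level excedance places: those `i` with `π_i ≥ i + g` and `π_i ≥ ℓ`. -/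
def gExcp (g ℓ : ℕ) {n : ℕ} (π : Equiv.Perm (Fin n)) : Finset (Fin n) :=
  univ.filter fun i => place i + g ≤ letter π i ∧ ℓ ≤ letter π i

/-- The set of places that are not `g`-gap `ℓ`-level excedance places. -/
def gNexcp (g ℓ : ℕ) {n : ℕ} (π : Equiv.Perm (Fin n)) : Finset (Fin n) :=
  (gExcp g ℓ π)ᶜ

/-- The `g`-gap `ℓ`-level Denert statistic. Here `i + g - 1` is never
truncated, since `i ≥ 1`. -/
def gden (g ℓ : ℕ) {n : ℕ} (π : Equiv.Perm (Fin n)) : ℕ :=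
  (∑ i ∈ gExcp g ℓ π, (place i + g - 1)) + invOn π (gExcp g ℓ π) + invOn π (gNexcp g ℓ π)

/-- The `g`-gap `ℓ`-level excedance number: the number of `i ≥ ℓ` with `π_i ≥ i + g`. -/
def gexc (g ℓ : ℕ) {n : ℕ} (π : Equiv.Perm (Fin n)) : ℕ :=
  #(univ.filter fun i : Fin n => place i + g ≤ letter π i ∧ ℓ ≤ place i)

/-- The generating polynomial `∑_{π ∈ 𝔖ₙ} t ^ st₁(π) * q ^ st₂(π)` of a pair of statistics,
with `t = X 0` and `q = X 1`. -/
noncomputable def jointGenPoly (st₁ st₂ : ∀ {n : ℕ}, Equiv.Perm (Fin n) → ℕ) (n : ℕ) :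
    MvPolynomial (Fin 2) ℤ :=
  ∑ π : Equiv.Perm (Fin n), MvPolynomial.X 0 ^ st₁ π * MvPolynomial.X 1 ^ st₂ π

/-- A pair of permutation statistics is `r`-Euler-Mahonian if, over every `𝔖ₙ`, it has the same
joint generating polynomial as the pair of the `r`-descent number and the `r`-major index. -/
def IsEulerMahonian (r : ℕ) (st₁ st₂ : ∀ {n : ℕ}, Equiv.Perm (Fin n) → ℕ) : Prop :=
  ∀ n : ℕ, jointGenPoly st₁ st₂ n = jointGenPoly (rdes r) (rmaj r) n

/-! Write `L = ℓ - 1` and count places and letters from `0`, so that `r = g + L`. Both sides are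
built by the same insertion rule: a permutation with statistics `(k, d)` has, for each `c = 0, …,
N`, one extension in which the second statistic grows by `c`, and the first grows by one exactly if
`c ≥ k + r`. The operator `insertionOp` records this rule.

For `(rdes, rmaj)` the largest letter is inserted; the slots creating no new `r`-descent receive the
small labels (`rmaj_insertTop`, `rdes_insertTop_eq`).

For the Denert pair, `gden_eq_sum_cost` writes `gden` as a sum over places `j` of a local `cost`:
the number of earlier letters in a cyclic interval from the letter at `j` to the threshold `max (j +
g) L`. Only places `j ≥ L` affect `gexc`, so the high places (`j ≥ L`) and the low ones are treated
separately. On the high places `denExtend` realizes the insertion rule: a place is inserted at `x`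
and the excedance letters from about `x + g` on are pushed up cyclically, so that the shifted places
keep their excedance status; for `x < L` the place is inserted at `L` and then exchanged with `x`
(`highCost_denExtend`, `highExc_denExtend`, `denExtend_injective`).

On a low place `j` the cost is a cyclic rank among the letters of the places up to `j`. Permuting
the low letters changes no high statistic and makes this rank uniform on `0, …, j`
(`factorial_smul_sum_perm`). The low places thus contribute the operator `fillOp`, which commutes
with `insertionOp`. At length `L` the high statistics vanish, while permutations of length at most
`r` have no `r`-descents, so that their `rmaj` also gives `fillOp`. Induction on the length yields
the identity multiplied by `L!` (`sum_fillOp_highExc`), and the factorial cancels. -/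

/-- The permutation of `Fin (N + 1)` obtained from `π` by inserting the largest letter at `x`. -/
def insertTop {N : ℕ} (π : Equiv.Perm (Fin N)) (x : Fin (N + 1)) : Equiv.Perm (Fin (N + 1)) :=
  (finSuccEquiv' x).trans ((Equiv.optionCongr π).trans (finSuccEquiv' (Fin.last N)).symm)

@[simp] lemma insertTop_self {N : ℕ} (π : Equiv.Perm (Fin N)) (x : Fin (N + 1)) :
    insertTop π x x = Fin.last N := by
  simp [insertTop]

@[simp] lemma insertTop_succAbove {N : ℕ} (π : Equiv.Perm (Fin N)) (x : Fin (N + 1)) (i : Fin N) :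
    insertTop π x (x.succAbove i) = (π i).castSucc := by
  simp [insertTop]

lemma insertTop_left_injective {N : ℕ} (x : Fin (N + 1)) :
    Function.Injective fun π : Equiv.Perm (Fin N) => insertTop π x := by
  intro π σ h
  ext i
  have := congrArg (fun τ : Equiv.Perm (Fin (N + 1)) => τ (x.succAbove i)) h
  simpa [Fin.ext_iff] using this

lemma insertTop_injective {N : ℕ} :
    Function.Injective fun p : Equiv.Perm (Fin N) × Fin (N + 1) => insertTop p.1 p.2 := by
  rintro ⟨π, x⟩ ⟨σ, y⟩ h
  simp only at h
  have hxy : x = y := by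
    apply (insertTop σ y).injective
    rw [insertTop_self, ← h, insertTop_self]
  subst hxy
  rw [insertTop_left_injective x h]

/-! ### The abstract insertion recursion and slot labels -/

/-- The operator on weights `f k d` that describes inserting a letter into a permutation of length
`N - 1`: the second statistic grows by `c`, the first by one precisely if `c ≥ k + r`. -/
def insertionOp {R : Type*} [AddCommMonoid R] (r N : ℕ) (f : ℕ → ℕ → R) (k d : ℕ) : R :=
  ∑ c ∈ range N, f (k + if k + r ≤ c then 1 else 0) (d + c)

/-- Injectivity suffices: source and target of `Φ` both have `(N + 1)!` elements, and `N + 1`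
distinct labels at most `N` exhaust `0, …, N`. -/
lemma sum_perm_eq_insertionOp {R : Type*} [AddCommMonoid R] {r N : ℕ}
    (s d : Equiv.Perm (Fin N) → ℕ) (s' d' : Equiv.Perm (Fin (N + 1)) → ℕ)
    (Φ : Equiv.Perm (Fin N) × Fin (N + 1) → Equiv.Perm (Fin (N + 1))) (hΦ : Function.Injective Φ)
    (c : Equiv.Perm (Fin N) → Fin (N + 1) → ℕ) (hc : ∀ π, Function.Injective (c π))
    (hlt : ∀ π x, c π x ≤ N) (hd : ∀ π x, d' (Φ (π, x)) = d π + c π x)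
    (hs : ∀ π x, s' (Φ (π, x)) = s π + if s π + r ≤ c π x then 1 else 0) (f : ℕ → ℕ → R) :
    ∑ σ, f (s' σ) (d' σ) = ∑ π, insertionOp r (N + 1) f (s π) (d π) := by
  have hb : Function.Bijective Φ := by
    rw [Fintype.bijective_iff_injective_and_card]
    refine ⟨hΦ, ?_⟩
    simp [Fintype.card_perm, Nat.factorial_succ, mul_comm]
  rw [← hb.sum_comp, Fintype.sum_prod_type]
  refine sum_congr rfl fun π _ => ?_
  have himg : range (N + 1) = univ.image (c π) := by
    symm
    apply eq_of_subset_of_card_le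
    · intro a ha
      simp only [mem_image, mem_univ, true_and] at ha
      obtain ⟨x, rfl⟩ := ha
      exact mem_range.2 (Nat.lt_succ_of_le (hlt π x))
    · rw [card_image_of_injective _ (hc π)]
      simp
  rw [insertionOp, himg, sum_image fun a _ b _ h => hc π h]
  exact sum_congr rfl fun x _ => by rw [hd, hs]

/-- The number of indices `j` with `x ≤ j < N` and `sp j`. -/
def countFrom (N : ℕ) (sp : ℕ → Prop) [DecidablePred sp] (x : ℕ) : ℕ :=
  ∑ j ∈ Ico x N, if sp j then 1 else 0

section countFrom

variable {N : ℕ} {sp : ℕ → Prop} [DecidablePred sp]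

lemma countFrom_eq {x : ℕ} (h : x < N) :
    countFrom N sp x = (if sp x then 1 else 0) + countFrom N sp (x + 1) := by
  rw [countFrom, sum_eq_sum_Ico_succ_bot h, countFrom]

lemma countFrom_antitone {x y : ℕ} (h : x ≤ y) : countFrom N sp y ≤ countFrom N sp x :=
  sum_le_sum_of_subset (Ico_subset_Ico_left h)

lemma countFrom_le_add {x y : ℕ} (h : x ≤ y) : countFrom N sp x ≤ countFrom N sp y + (y - x) := by
  rcases le_or_gt y N with hy | hy
  · rw [countFrom, ← sum_Ico_consecutive _ h hy, add_comm, countFrom]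
    gcongr
    calc _ ≤ ∑ j ∈ Ico x y, 1 := sum_le_sum fun _ _ => by split_ifs <;> simp
      _ = y - x := by simp
  · calc _ ≤ ∑ j ∈ Ico x N, 1 := sum_le_sum fun _ _ => by split_ifs <;> simp
      _ = N - x := by simp
      _ ≤ _ := by omega

lemma countFrom_of_le {x : ℕ} (h : N ≤ x) : countFrom N sp x = 0 := by
  simp [countFrom, Ico_eq_empty_of_le h]

end countFrom

/-- The growth of the second statistic when a letter is inserted at slot `x`: special slots are
numbered from right to left, then come the slots `x ≤ L` in the order of `ρ`, and then the
remaining slots from left to right. -/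
def slotLabel (N L : ℕ) (sp : ℕ → Prop) [DecidablePred sp] (ρ : ℕ → ℕ) (x : ℕ) : ℕ :=
  if x ≤ L then countFrom N sp L + ρ x
  else countFrom N sp x + if sp (x - 1) then 0 else x

section slotLabel

variable {N L : ℕ} {sp : ℕ → Prop} [DecidablePred sp] {ρ : ℕ → ℕ}

lemma slotLabel_lt_of_special {x : ℕ} (hx : L < x) (hxN : x ≤ N) (h : sp (x - 1)) :
    slotLabel N L sp ρ x < countFrom N sp L := by
  have h1 := countFrom_eq (N := N) (sp := sp) (x := x - 1) (by omega)
  have h2 := countFrom_antitone (N := N) (sp := sp) (x := L) (y := x - 1) (by omega)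
  rw [show x - 1 + 1 = x by omega] at h1
  simp only [slotLabel, h, not_le.2 hx, if_true, if_false] at h1 ⊢
  omega

lemma lt_slotLabel_of_not_special {x : ℕ} (hx : L < x) (hxN : x ≤ N) (h : ¬ sp (x - 1)) :
    countFrom N sp L + L < slotLabel N L sp ρ x := by
  have h1 := countFrom_eq (N := N) (sp := sp) (x := x - 1) (by omega)
  have h2 := countFrom_le_add (N := N) (sp := sp) (x := L) (y := x - 1) (by omega)
  rw [show x - 1 + 1 = x by omega] at h1
  simp only [slotLabel, h, not_le.2 hx, if_false] at h1 ⊢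
  omega

lemma slotLabel_lt_slotLabel_of_special {x y : ℕ} (hx : L < x) (hxy : x < y) (hyN : y ≤ N)
    (h : sp (x - 1)) (h' : sp (y - 1)) : slotLabel N L sp ρ y < slotLabel N L sp ρ x := by
  have h1 := countFrom_eq (N := N) (sp := sp) (x := y - 1) (by omega)
  have h2 := countFrom_antitone (N := N) (sp := sp) (x := x) (y := y - 1) (by omega)
  rw [show y - 1 + 1 = y by omega] at h1
  simp only [slotLabel, h, h', not_le.2 hx, not_le.2 (hx.trans hxy), if_true, if_false] at h1 ⊢
  omega

lemma slotLabel_lt_slotLabel_of_not_special {x y : ℕ} (hx : L < x) (hxy : x < y) (hyN : y ≤ N)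
    (h : ¬ sp (x - 1)) (h' : ¬ sp (y - 1)) : slotLabel N L sp ρ x < slotLabel N L sp ρ y := by
  have h1 := countFrom_eq (N := N) (sp := sp) (x := y - 1) (by omega)
  have h2 := countFrom_le_add (N := N) (sp := sp) (x := x) (y := y - 1) (by omega)
  rw [show y - 1 + 1 = y by omega] at h1
  simp only [slotLabel, h, h', not_le.2 hx, not_le.2 (hx.trans hxy), if_false] at h1 ⊢
  omega

lemma slotLabel_le (hL : L ≤ N) (hρ : ∀ x ≤ L, ρ x ≤ L) {x : ℕ} (hx : x ≤ N) :
    slotLabel N L sp ρ x ≤ N := by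
  have h2 := countFrom_le_add (N := N) (sp := sp) (x := L) (y := N) hL
  have h3 := countFrom_le_add (N := N) (sp := sp) (x := x) (y := N) hx
  rw [countFrom_of_le le_rfl] at h2 h3
  rw [slotLabel]
  split_ifs with h h'
  · have := hρ x h
    omega
  · omega
  · omega

/-- With `C = countFrom N sp L`, the three kinds of slots use disjoint ranges: special ones lie
below `C`, the slots `x ≤ L` lie in `[C, C + L]`, the others lie above. Within each range the label
is monotone or governed by the injective `ρ`. -/
lemma slotLabel_injOn (hρ : ∀ x ≤ L, ρ x ≤ L)
    (hinj : ∀ x ≤ L, ∀ y ≤ L, ρ x = ρ y → x = y) {x y : ℕ} (hx : x ≤ N) (hy : y ≤ N)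
    (h : slotLabel N L sp ρ x = slotLabel N L sp ρ y) : x = y := by
  wlog hxy : x ≤ y generalizing x y
  · exact (this hy hx h.symm (by omega)).symm
  by_contra hne
  have hlt : x < y := by omega
  by_cases hxL : x ≤ L
  · have ex : slotLabel N L sp ρ x = countFrom N sp L + ρ x := by simp [slotLabel, hxL]
    have := hρ x hxL
    by_cases hyL : y ≤ L
    · have ey : slotLabel N L sp ρ y = countFrom N sp L + ρ y := by simp [slotLabel, hyL]
      exact hne (hinj x hxL y hyL (by omega))
    · by_cases hs : sp (y - 1)
      · have := slotLabel_lt_of_special (ρ := ρ) (not_le.1 hyL) hy hs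
        omega
      · have := lt_slotLabel_of_not_special (ρ := ρ) (not_le.1 hyL) hy hs
        omega
  · have hx' := not_le.1 hxL
    by_cases hs : sp (x - 1) <;> by_cases hs' : sp (y - 1)
    · have := slotLabel_lt_slotLabel_of_special (ρ := ρ) hx' hlt hy hs hs'
      omega
    · have := slotLabel_lt_of_special (ρ := ρ) hx' hx hs
      have := lt_slotLabel_of_not_special (ρ := ρ) (hx'.trans hlt) hy hs'
      omega
    · have := slotLabel_lt_of_special (ρ := ρ) (hx'.trans hlt) hy hs'
      have := lt_slotLabel_of_not_special (ρ := ρ) hx' hx hs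
      omega
    · have := slotLabel_lt_slotLabel_of_not_special (ρ := ρ) hx' hlt hy hs hs'
      omega

end slotLabel

/-! ### Words as functions on the natural numbers -/

/-- The word of `π`, extended by `i ↦ i` beyond its end. -/
def word {N : ℕ} (π : Equiv.Perm (Fin N)) (i : ℕ) : ℕ := if h : i < N then π ⟨i, h⟩ else i

section word

variable {N : ℕ} (π : Equiv.Perm (Fin N))

lemma word_val (i : Fin N) : word π i = π i := by simp [word]

lemma word_lt {i : ℕ} (h : i < N) : word π i < N := by simp [word, h]

/-- The value `N` just after the end exceeds every letter. So, for `r ≥ 1`, the last place is never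
an `r`-descent, and the slot at the end counts as special. -/
lemma word_of_le {i : ℕ} (h : N ≤ i) : word π i = i := by simp [word, not_lt.2 h]

lemma word_insertTop_of_lt {x i : ℕ} (hx : x < N + 1) (h : i < x) :
    word (insertTop π ⟨x, hx⟩) i = word π i := by
  have hi : i < N := by omega
  have : (⟨i, by omega⟩ : Fin (N + 1)) = Fin.succAbove ⟨x, hx⟩ ⟨i, hi⟩ := by
    rw [Fin.succAbove_of_castSucc_lt _ _ (by simpa [Fin.lt_def] using h)]
    rfl
  simp only [word, hi, show i < N + 1 by omega, dif_pos]
  rw [this, insertTop_succAbove]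
  simp

lemma word_insertTop_self {x : ℕ} (hx : x < N + 1) : word (insertTop π ⟨x, hx⟩) x = N := by
  simp [word, hx]

lemma word_insertTop_succ {x i : ℕ} (hx : x < N + 1) (h : x ≤ i) (hi : i < N) :
    word (insertTop π ⟨x, hx⟩) (i + 1) = word π i := by
  have : (⟨i + 1, by omega⟩ : Fin (N + 1)) = Fin.succAbove ⟨x, hx⟩ ⟨i, hi⟩ := by
    rw [Fin.succAbove_of_le_castSucc _ _ (by simpa [Fin.le_def] using h)]
    rfl
  simp only [word, hi, show i + 1 < N + 1 by omega, dif_pos]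
  rw [this, insertTop_succAbove]
  simp

end word

lemma sum_range_succ_split {N x : ℕ} (hx : x ≤ N) (F : ℕ → ℕ) :
    ∑ i ∈ range (N + 1), F i = ∑ i ∈ range x, F i + (F x + ∑ i ∈ Ico x N, F (i + 1)) := by
  rw [range_eq_Ico, ← sum_Ico_consecutive _ (Nat.zero_le x) (show x ≤ N + 1 by omega),
    sum_eq_sum_Ico_succ_bot (by omega : x < N + 1), sum_Ico_add', ← range_eq_Ico]

/-! ### Inserting the largest letter: `r`-descents and the `r`-major index -/

section major

variable {N : ℕ} (r : ℕ) (π : Equiv.Perm (Fin N))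

lemma mem_rDes (i : Fin N) (hr : 1 ≤ r) :
    i ∈ rDes r π ↔ word π (i + 1) + r ≤ word π i := by
  rw [rDes, mem_filter]
  simp only [place, letter, mem_univ, true_and]
  constructor
  · rintro ⟨j, hj, h⟩
    have : (i : ℕ) + 1 = j := by omega
    rw [this, word_val, word_val]
    omega
  · intro h
    rcases lt_or_ge ((i : ℕ) + 1) N with hi | hi
    · refine ⟨⟨i + 1, hi⟩, rfl, ?_⟩
      have := word_val π ⟨i + 1, hi⟩
      have := word_val π i
      simp only at *
      omega
    · have h1 := word_of_le π hi
      have h2 := word_lt π i.2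
      omega

lemma sum_rDes (hr : 1 ≤ r) (F : ℕ → ℕ) :
    ∑ i ∈ rDes r π, F i = ∑ i ∈ range N, if word π (i + 1) + r ≤ word π i then F i else 0 := by
  rw [← Fin.sum_univ_eq_sum_range
    (fun i => if word π (i + 1) + r ≤ word π i then F i else 0), ← sum_filter]
  refine sum_congr ?_ fun _ _ => rfl
  ext i
  simp [mem_rDes r π i hr]

lemma card_rInv : #(rInv r π) = ∑ i, ∑ j, if i < j ∧ π j < π i ∧ (π i : ℕ) < π j + r then 1 else 0 := by
  rw [rInv, invSet, filter_filter, card_filter, ← Fintype.sum_prod_type']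
  refine sum_congr rfl fun p _ => ?_
  refine if_congr ?_ rfl rfl
  simp only [letter, Fin.lt_def]
  omega

lemma card_rInv_insertTop {x : ℕ} (hx : x < N + 1) :
    #(rInv r (insertTop π ⟨x, hx⟩))
      = #(rInv r π) + ∑ j ∈ Ico x N, if N < word π j + r then 1 else 0 := by
  rw [card_rInv, card_rInv, Fin.sum_univ_succAbove _ (⟨x, hx⟩ : Fin (N + 1)), add_comm]
  congr 1
  · refine sum_congr rfl fun i _ => ?_
    rw [Fin.sum_univ_succAbove _ (⟨x, hx⟩ : Fin (N + 1))]
    simp only [insertTop_self, insertTop_succAbove, Fin.succAbove_lt_succAbove_iff,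
      Fin.castSucc_lt_castSucc_iff, Fin.val_castSucc]
    rw [if_neg (by simp [Fin.lt_def, (π i).2.le]), zero_add]
  · rw [Fin.sum_univ_succAbove _ (⟨x, hx⟩ : Fin (N + 1))]
    simp only [insertTop_self, insertTop_succAbove, lt_self_iff_false, false_and, if_false,
      zero_add, Fin.castSucc_lt_last, true_and, Fin.val_castSucc, Fin.val_last]
    have : ∀ i : Fin N, (⟨x, hx⟩ : Fin (N + 1)) < Fin.succAbove ⟨x, hx⟩ i ↔ x ≤ (i : ℕ) := by
      intro i
      rw [Fin.lt_succAbove_iff_le_castSucc]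
      simp [Fin.le_def]
    simp only [this]
    rw [show Ico x N = (range N).filter (x ≤ ·) by ext; simp [and_comm], sum_filter,
      ← Fin.sum_univ_eq_sum_range (fun j => if x ≤ j then if N < word π j + r then 1 else 0 else 0)]
    refine sum_congr rfl fun i _ => ?_
    rw [word_val, ite_and]

/-- The descent across the slot, which the insertion may destroy, stands on the left to avoid
subtraction. For `x = 0` the truncated `x - 1` compares a letter with itself, so that term vanishes
as `r ≥ 1`. -/
lemma sum_rDes_insertTop (hr : 1 ≤ r) {x : ℕ} (hx : x < N + 1) (F : ℕ → ℕ) :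
    ∑ i ∈ rDes r (insertTop π ⟨x, hx⟩), F i
        + (if word π x + r ≤ word π (x - 1) then F (x - 1) else 0)
      = ∑ i ∈ range x, (if word π (i + 1) + r ≤ word π i then F i else 0)
        + ((if word π x + r ≤ N then F x else 0)
          + ∑ i ∈ Ico x N, if word π (i + 1) + r ≤ word π i then F (i + 1) else 0) := by
  rw [sum_rDes _ _ hr, sum_range_succ_split (by omega : x ≤ N)]
  have h1 : ∑ i ∈ range x, (if word (insertTop π ⟨x, hx⟩) (i + 1) + r
        ≤ word (insertTop π ⟨x, hx⟩) i then F i else 0)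
        + (if word π x + r ≤ word π (x - 1) then F (x - 1) else 0)
      = ∑ i ∈ range x, (if word π (i + 1) + r ≤ word π i then F i else 0) := by
    rcases x with _ | x
    · simp; omega
    · rw [sum_range_succ, sum_range_succ, word_insertTop_self,
        word_insertTop_of_lt _ _ (by omega : x < x + 1)]
      have := word_lt π (by omega : x < N)
      rw [if_neg (by omega), add_zero]
      simp only [Nat.add_sub_cancel]
      congr 1
      refine sum_congr rfl fun i hi => ?_
      have := mem_range.1 hi
      rw [word_insertTop_of_lt _ _ (by omega), word_insertTop_of_lt _ _ (by omega)]
  have h2 : word (insertTop π ⟨x, hx⟩) (x + 1) + r ≤ word (insertTop π ⟨x, hx⟩) x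
      ↔ word π x + r ≤ N := by
    rw [word_insertTop_self]
    rcases lt_or_ge x N with h | h
    · rw [word_insertTop_succ _ _ le_rfl h]
    · rw [word_of_le _ (by omega), word_of_le _ h]
      omega
  have h3 : ∀ i ∈ Ico x N, (if word (insertTop π ⟨x, hx⟩) (i + 1 + 1) + r
        ≤ word (insertTop π ⟨x, hx⟩) (i + 1) then F (i + 1) else 0)
      = if word π (i + 1) + r ≤ word π i then F (i + 1) else 0 := by
    intro i hi
    obtain ⟨h, h'⟩ := mem_Ico.1 hi
    rw [word_insertTop_succ _ _ h h']
    rcases lt_or_ge (i + 1) N with h'' | h''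
    · rw [word_insertTop_succ _ _ (by omega) h'']
    · have := word_lt π h'
      rw [word_of_le _ (by omega), if_neg (by omega), word_of_le _ h'', if_neg (by omega)]
  rw [sum_congr rfl h3, ← h1]
  simp only [h2]
  ring

/-- The slots of `π` after its place `j` at which inserting the largest letter creates no
`r`-descent. -/
def MajSpecial (j : ℕ) : Prop := word π (j + 1) + r ≤ word π j ∨ N < word π (j + 1) + r

instance : DecidablePred (MajSpecial r π) := fun _ => inferInstanceAs (Decidable (_ ∨ _))

/-- The two conditions in `MajSpecial` exclude each other. The second looks at place `i + 1`;
shifting it back to `i` trades the term at `x` for the one at `N`, which is the final `1`. -/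
lemma countFrom_majSpecial (hr : 1 ≤ r) {x : ℕ} (hx : x ≤ N) :
    countFrom N (MajSpecial r π) x + (if N < word π x + r then 1 else 0)
      = ∑ i ∈ Ico x N, (if word π (i + 1) + r ≤ word π i then 1 else 0)
        + (∑ i ∈ Ico x N, if N < word π i + r then 1 else 0) + 1 := by
  have h1 : ∀ i ∈ Ico x N, (if MajSpecial r π i then 1 else 0)
      = (if word π (i + 1) + r ≤ word π i then 1 else 0)
        + if N < word π (i + 1) + r then 1 else 0 := by
    intro i hi
    have := word_lt π (mem_Ico.1 hi).2
    by_cases h : word π (i + 1) + r ≤ word π i <;> by_cases h' : N < word π (i + 1) + r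
    · omega
    all_goals simp [MajSpecial, h, h']
  rw [countFrom, sum_congr rfl h1, sum_add_distrib, add_assoc, add_assoc]
  congr 1
  rw [sum_Ico_add' (fun i => if N < word π i + r then 1 else 0) x N 1, add_comm,
    ← sum_eq_sum_Ico_succ_bot (f := fun i => if N < word π i + r then 1 else 0)
      (by omega : x < N + 1), sum_Ico_succ_top hx]
  rw [word_of_le π le_rfl, if_pos (by omega : N < N + r)]

lemma rmaj_insertTop (hr : 1 ≤ r) {x : ℕ} (hx : x < N + 1) :
    rmaj r (insertTop π ⟨x, hx⟩) = rmaj r π + slotLabel N 0 (MajSpecial r π) (fun _ => 0) x := by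
  have h1 := sum_rDes_insertTop r π hr hx (· + 1)
  have h2 := sum_rDes r π hr (· + 1)
  have h3 := card_rInv_insertTop r π hx
  have h4 := countFrom_majSpecial r π hr (x := x) (by omega)
  have hs : ∑ i ∈ Ico x N, (if word π (i + 1) + r ≤ word π i then i + 1 + 1 else 0)
      = ∑ i ∈ Ico x N, (if word π (i + 1) + r ≤ word π i then i + 1 else 0)
        + ∑ i ∈ Ico x N, (if word π (i + 1) + r ≤ word π i then 1 else 0) := by
    rw [← sum_add_distrib]
    refine sum_congr rfl fun i _ => ?_
    split_ifs <;> rfl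
  rw [range_eq_Ico, ← sum_Ico_consecutive _ (Nat.zero_le x) (by omega : x ≤ N),
    ← range_eq_Ico] at h2
  rw [rmaj, rmaj, h3]
  simp only [place]
  rw [slotLabel]
  rcases x with _ | x
  · simp only [Nat.zero_sub, range_zero, sum_empty] at *
    rw [if_pos le_rfl]
    split_ifs at * <;> omega
  · have := word_lt π (by omega : x < N)
    simp only [Nat.add_sub_cancel, MajSpecial] at *
    rw [if_neg (by omega)]
    split_ifs at * <;> omega

lemma rdes_insertTop (hr : 1 ≤ r) {x : ℕ} (hx : x < N + 1) :
    rdes r (insertTop π ⟨x, hx⟩) + (if word π x + r ≤ word π (x - 1) then 1 else 0)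
      = rdes r π + if word π x + r ≤ N then 1 else 0 := by
  have h1 := sum_rDes_insertTop r π hr hx (fun _ => 1)
  have h2 := sum_rDes r π hr (fun _ => 1)
  rw [range_eq_Ico, ← sum_Ico_consecutive _ (Nat.zero_le x) (by omega : x ≤ N),
    ← range_eq_Ico] at h2
  simp only [sum_const, smul_eq_mul, mul_one] at h1 h2
  rw [rdes, rdes, h1, h2]
  ring

lemma sum_large (hrN : r ≤ N + 1) (hr : 1 ≤ r) :
    (∑ i ∈ Ico 0 N, if N < word π i + r then 1 else 0) = r - 1 := by
  rw [← range_eq_Ico, ← Fin.sum_univ_eq_sum_range (fun i => if N < word π i + r then 1 else 0)]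
  simp only [word_val]
  rw [Equiv.sum_comp π (fun v : Fin N => if N < (v : ℕ) + r then 1 else 0),
    Fin.sum_univ_eq_sum_range (fun v => if N < v + r then 1 else 0), ← sum_filter,
    show (range N).filter (fun v => N < v + r) = Ico (N + 1 - r) N by
      ext; simp only [mem_filter, mem_range, mem_Ico]; omega]
  simp
  omega

lemma rdes_eq_zero (h : N ≤ r) (hr : 1 ≤ r) : rdes r π = 0 := by
  rw [rdes, card_eq_zero, eq_empty_iff_forall_notMem]
  intro i hi
  rw [mem_rDes r π i hr] at hi
  have := word_lt π i.2
  omega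

/-- If `r ≤ N + 1`, the number of special slots is `rdes r π + r`, less one if the first letter is
among the `r - 1` largest. Hence special slots have labels below `rdes r π + r`, other positive
slots have labels at least that, and slot `0` reaches the bound exactly if it creates a descent. -/
lemma rdes_insertTop_eq (hr : 1 ≤ r) {x : ℕ} (hx : x < N + 1) :
    rdes r (insertTop π ⟨x, hx⟩) = rdes r π
      + if rdes r π + r ≤ slotLabel N 0 (MajSpecial r π) (fun _ => 0) x then 1 else 0 := by
  rcases lt_or_ge (N + 1) r with h | h
  · rw [rdes_eq_zero _ _ (by omega) hr, rdes_eq_zero _ _ (by omega) hr, if_neg]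
    have := slotLabel_le (sp := MajSpecial r π) (ρ := fun _ => 0) (L := 0) (Nat.zero_le N)
      (by simp) (by omega : x ≤ N)
    omega
  · have h1 := rdes_insertTop r π hr hx
    have h2 := countFrom_majSpecial r π hr (Nat.zero_le N)
    rw [sum_large r π h hr, ← range_eq_Ico, ← sum_rDes r π hr (fun _ => 1), sum_const,
      smul_eq_mul, mul_one, ← rdes] at h2
    rcases Nat.eq_zero_or_pos x with rfl | hx0
    · simp only [slotLabel, le_refl, if_true, Nat.zero_sub] at *
      split_ifs at * <;> omega
    · have hw := word_lt π (by omega : x - 1 < N)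
      have e : x - 1 + 1 = x := by omega
      by_cases hs : MajSpecial r π (x - 1)
      · have := slotLabel_lt_of_special (ρ := fun _ => 0) hx0 (by omega : x ≤ N) hs
        rw [MajSpecial, e] at hs
        split_ifs at * <;> omega
      · have := lt_slotLabel_of_not_special (ρ := fun _ => 0) hx0 (by omega : x ≤ N) hs
        rw [MajSpecial, e] at hs
        split_ifs at * <;> omega

end major

lemma sum_rdes_rmaj_succ {R : Type*} [AddCommMonoid R] {r : ℕ} (hr : 1 ≤ r) (N : ℕ)
    (f : ℕ → ℕ → R) :
    ∑ σ : Equiv.Perm (Fin (N + 1)), f (rdes r σ) (rmaj r σ)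
      = ∑ π : Equiv.Perm (Fin N), insertionOp r (N + 1) f (rdes r π) (rmaj r π) :=
  sum_perm_eq_insertionOp _ _ _ _ (fun p => insertTop p.1 p.2) insertTop_injective
    (fun π x => slotLabel N 0 (MajSpecial r π) (fun _ => 0) x)
    (fun π x y h => Fin.ext <| slotLabel_injOn (by simp) (by omega) (by omega) (by omega) h)
    (fun π x => slotLabel_le (Nat.zero_le N) (by simp) (by omega))
    (fun π x => rmaj_insertTop r π hr x.2) (fun π x => rdes_insertTop_eq r π hr x.2) f

/-! ### Cyclic ranks, place costs and averaging over low places -/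

/-- The letter `u` lies strictly between `v` and `T` in the cyclic order, that is in the cyclic
interval of the letters following `v` and preceding `T`. -/
def CycBetween (T v u : ℕ) : Prop := (v < T ∧ v < u ∧ u < T) ∨ (T ≤ v ∧ (v < u ∨ u < T))

instance (T v u : ℕ) : Decidable (CycBetween T v u) := inferInstanceAs (Decidable (_ ∨ _))

lemma cycBetween_iff {T v u : ℕ} :
    CycBetween T v u ↔ (v < T ∧ v < u ∧ u < T) ∨ (T ≤ v ∧ (v < u ∨ u < T)) := Iff.rfl

section cycBetween

variable {ι : Type*} {I : Finset ι} {w : ι → ℕ} {T : ℕ}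

lemma card_cycBetween_lt {x y : ι} (hy : y ∈ I)
    (h : w x < w y) (hT : T ≤ w x ∨ w y < T) :
    #{i ∈ I | CycBetween T (w y) (w i)} < #{i ∈ I | CycBetween T (w x) (w i)} := by
  apply card_lt_card
  rw [ssubset_iff_of_subset]
  · refine ⟨y, ?_, ?_⟩ <;> simp only [mem_filter, hy, true_and, cycBetween_iff] <;> omega
  · intro i
    simp only [mem_filter, cycBetween_iff]
    rintro ⟨hi, h'⟩
    exact ⟨hi, by omega⟩

/-- The cyclic rank counts downwards from `T - 1` to `0` and then from the top down to `T`, so the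
letters from `T` on are ranked after all those below `T`. -/
lemma le_iff_card_le_card_cycBetween {x : ι} (hx : x ∈ I) :
    T ≤ w x ↔ #{i ∈ I | w i < T} ≤ #{i ∈ I | CycBetween T (w x) (w i)} := by
  constructor
  · intro h
    apply card_le_card
    intro i
    simp only [mem_filter, cycBetween_iff]
    rintro ⟨hi, h'⟩
    exact ⟨hi, by omega⟩
  · contrapose!
    intro h
    apply card_lt_card
    rw [ssubset_iff_of_subset]
    · refine ⟨x, ?_, ?_⟩ <;> simp only [mem_filter, hx, true_and, cycBetween_iff] <;> omega
    · intro i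
      simp only [mem_filter, cycBetween_iff]
      rintro ⟨hi, h'⟩
      exact ⟨hi, by omega⟩

lemma card_cycBetween_lt_card {x : ι} (hx : x ∈ I) :
    #{i ∈ I | CycBetween T (w x) (w i)} < #I := by
  apply card_lt_card
  rw [ssubset_iff_of_subset (filter_subset _ _)]
  refine ⟨x, hx, ?_⟩
  simp only [mem_filter, hx, true_and, cycBetween_iff]
  omega

lemma card_cycBetween_injOn (hw : Set.InjOn w I) {x y : ι} (hx : x ∈ I) (hy : y ∈ I)
    (h : #{i ∈ I | CycBetween T (w x) (w i)} = #{i ∈ I | CycBetween T (w y) (w i)}) : x = y := by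
  by_contra hne
  have hne' : w x ≠ w y := fun h => hne (hw hx hy h)
  have hx' := le_iff_card_le_card_cycBetween (w := w) (T := T) hx
  have hy' := le_iff_card_le_card_cycBetween (w := w) (T := T) hy
  rw [h, ← hy'] at hx'
  rcases lt_or_gt_of_ne hne' with hlt | hlt
  · have := card_cycBetween_lt (T := T) hy hlt (by omega)
    omega
  · have := card_cycBetween_lt (T := T) hx hlt (by omega)
    omega

end cycBetween

section word

variable {N : ℕ} (π : Equiv.Perm (Fin N))

lemma word_injective : Function.Injective (word π) := by
  intro i j h
  rcases lt_or_ge i N with hi | hi <;> rcases lt_or_ge j N with hj | hj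
  · simpa [word, hi, hj, Fin.val_inj] using h
  · have := word_lt π hi
    rw [h, word_of_le π hj] at this
    omega
  · have := word_lt π hj
    rw [← h, word_of_le π hi] at this
    omega
  · rwa [word_of_le π hi, word_of_le π hj] at h

lemma sum_range_word (F : ℕ → ℕ) : ∑ i ∈ range N, F (word π i) = ∑ v ∈ range N, F v := by
  rw [← Fin.sum_univ_eq_sum_range, ← Fin.sum_univ_eq_sum_range]
  simp only [word_val]
  exact Equiv.sum_comp π fun v : Fin N => F v

lemma word_mul_swap (a b : Fin N) (i : ℕ) :
    word (π * Equiv.swap a b) i = word π (Equiv.swap (a : ℕ) b i) := by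
  rcases lt_or_ge i N with hi | hi
  · have h : Equiv.swap (a : ℕ) b i = Equiv.swap a b ⟨i, hi⟩ := by
      simp only [Equiv.swap_apply_def, Fin.ext_iff]
      split_ifs <;> rfl
    rw [h, word_val]
    simp [word, hi]
  · rw [Equiv.swap_apply_of_ne_of_ne (by omega) (by omega), word_of_le _ hi, word_of_le _ hi]

lemma sum_range_swap {R : Type*} [AddCommMonoid R] {a b m : ℕ} (ha : a < m) (hb : b < m)
    (F : ℕ → R) : ∑ i ∈ range m, F (Equiv.swap a b i) = ∑ i ∈ range m, F i := by
  refine sum_equiv (Equiv.swap a b) (fun i => ?_) fun _ _ => rfl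
  simp only [mem_range, Equiv.swap_apply_def]
  split_ifs <;> omega

end word

/-- The number of letters before place `j` that lie between the letter of place `j` and the
threshold `T j` in the cyclic order. -/
def cost (T : ℕ → ℕ) {N : ℕ} (π : Equiv.Perm (Fin N)) (j : ℕ) : ℕ :=
  ∑ i ∈ range j, if CycBetween (T j) (word π j) (word π i) then 1 else 0

/-- The number of letters smaller than `t` in the places before `j`. -/
def below {N : ℕ} (π : Equiv.Perm (Fin N)) (j t : ℕ) : ℕ :=
  ∑ i ∈ range j, if word π i < t then 1 else 0

section cost

variable {N : ℕ} (T : ℕ → ℕ) (π : Equiv.Perm (Fin N))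

/-- Indicator by indicator, a cyclic interval is a difference of two initial segments, plus a full
turn when `T j ≤ word π j`. -/
lemma cost_add_below (j : ℕ) :
    cost T π j + below π j (word π j + 1)
      = below π j (T j) + if T j ≤ word π j then j else 0 := by
  have : (if T j ≤ word π j then j else 0) = ∑ _i ∈ range j, if T j ≤ word π j then 1 else 0 := by
    split_ifs <;> simp
  rw [this, cost, below, below, ← sum_add_distrib, ← sum_add_distrib]
  refine sum_congr rfl fun i hi => ?_
  have : word π i ≠ word π j := fun h => (mem_range.1 hi).ne (word_injective π h)
  simp only [cycBetween_iff]
  split_ifs <;> omega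

lemma cost_mul_swap_of_lt {j : ℕ} {a b : Fin N} (ha : (a : ℕ) < j) (hb : (b : ℕ) < j) :
    cost T (π * Equiv.swap a b) j = cost T π j := by
  simp only [cost, word_mul_swap]
  rw [Equiv.swap_apply_of_ne_of_ne (by omega : j ≠ a) (by omega : j ≠ b)]
  exact sum_range_swap ha hb fun i => if CycBetween (T j) (word π j) (word π i) then 1 else 0

/-- The letter brought to place `b` may be counted along with the others, since it is never strictly
between itself and the threshold. -/
lemma cost_mul_swap_self {a b : Fin N} (hab : a ≤ b) :
    cost T (π * Equiv.swap a b) b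
      = #{i ∈ range (b + 1) | CycBetween (T b) (word π a) (word π i)} := by
  simp only [cost, word_mul_swap, Equiv.swap_apply_right]
  rw [card_filter, ← sum_range_swap (by omega : (a : ℕ) < b + 1) (by omega : (b : ℕ) < b + 1),
    sum_range_succ, Equiv.swap_apply_right, if_neg (by simp only [cycBetween_iff]; omega), add_zero]

end cost

/-- Sum of the weights `h (d + c₁ + ⋯ + c_m)` over all `0 ≤ c_j < j`. -/
def fillOp {R : Type*} [AddCommMonoid R] (h : ℕ → R) : ℕ → ℕ → R
  | 0 => h
  | m + 1 => fun d => ∑ c ∈ range (m + 1), fillOp h m (d + c)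

lemma fillOp_add {R : Type*} [AddCommMonoid R] (h : ℕ → R) (e m d : ℕ) :
    fillOp (fun d => h (d + e)) m d = fillOp h m (d + e) := by
  induction m generalizing d with
  | zero => rfl
  | succ m ih =>
    simp only [fillOp]
    refine sum_congr rfl fun c _ => ?_
    rw [ih, add_right_comm]

lemma fillOp_sum {R ι : Type*} [AddCommMonoid R] (I : Finset ι) (h : ι → ℕ → R) (m d : ℕ) :
    fillOp (fun d => ∑ i ∈ I, h i d) m d = ∑ i ∈ I, fillOp (h i) m d := by
  induction m generalizing d with
  | zero => rfl
  | succ m ih =>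
    simp only [fillOp, ih]
    exact sum_comm

section fill

variable {R : Type*} [AddCommMonoid R] {N : ℕ} (T : ℕ → ℕ)

/-- Exchanging place `m` with each `x ≤ m` in turn puts every letter of the first `m + 1` places at
`m` once; the resulting costs are the cyclic ranks `0, …, m`, each once, and `G` does not notice the
exchange. -/
lemma sum_perm_cost {m : ℕ} (hm : m < N) (G : Equiv.Perm (Fin N) → ℕ → R)
    (hG : ∀ π, ∀ a b : Fin N, (a : ℕ) ≤ m → (b : ℕ) ≤ m → G (π * Equiv.swap a b) = G π) :
    (m + 1) • ∑ π, G π (cost T π m) = ∑ π, ∑ c ∈ range (m + 1), G π c := by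
  have h1 : ∀ x ∈ range (m + 1), ∑ π, G π (cost T π m)
      = ∑ π, G π #{i ∈ range (m + 1) | CycBetween (T m) (word π x) (word π i)} := by
    intro x hx
    have hx' := mem_range.1 hx
    rw [← Equiv.sum_comp (Equiv.mulRight (Equiv.swap (⟨x, by omega⟩ : Fin N) ⟨m, hm⟩))]
    refine sum_congr rfl fun π _ => ?_
    have := cost_mul_swap_self T π (a := ⟨x, by omega⟩) (b := ⟨m, hm⟩)
      (by simp [Fin.le_def]; omega)
    simp only [Equiv.coe_mulRight] at this ⊢
    rw [this, hG _ _ _ (by simp; omega) le_rfl]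
  rw [← card_range (m + 1), ← sum_const, card_range, sum_congr rfl h1, sum_comm]
  refine sum_congr rfl fun π _ => ?_
  have himg : range (m + 1) = (range (m + 1)).image
      fun x => #{i ∈ range (m + 1) | CycBetween (T m) (word π x) (word π i)} := by
    symm
    apply eq_of_subset_of_card_le
    · intro c hc
      obtain ⟨x, hx, rfl⟩ := mem_image.1 hc
      have := card_cycBetween_lt_card (w := word π) (T := T m) hx
      rw [card_range] at this
      exact mem_range.2 this
    · rw [card_image_of_injOn]
      intro x hx y hy h
      exact card_cycBetween_injOn (word_injective π).injOn hx hy h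
  conv_rhs => rw [himg]
  rw [sum_image]
  intro x hx y hy h
  exact card_cycBetween_injOn (word_injective π).injOn hx hy h

lemma factorial_smul_sum_perm {m : ℕ} (hm : m ≤ N) (h : Equiv.Perm (Fin N) → ℕ → R)
    (hh : ∀ π, ∀ a b : Fin N, (a : ℕ) < m → (b : ℕ) < m → h (π * Equiv.swap a b) = h π) :
    m.factorial • ∑ π, h π (∑ j ∈ range m, cost T π j) = ∑ π, fillOp (h π) m 0 := by
  induction m generalizing h with
  | zero => simp [fillOp]
  | succ m ih =>
    -- The cost of the last place is absorbed into the weight: exchanges among earlier places leave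
    -- it unchanged.
    have h1 := ih (by omega) (fun π d => h π (d + cost T π m)) (by
      intro π a b ha hb
      rw [hh π a b (by omega) (by omega), cost_mul_swap_of_lt T π ha hb])
    simp only [fillOp_add] at h1
    simp only [sum_range_succ]
    rw [Nat.factorial_succ, mul_smul, h1, sum_perm_cost T (by omega : m < N)
      (fun π d => fillOp (h π) m (0 + d))]
    · rfl
    · intro π a b ha hb
      rw [hh π a b (by omega) (by omega)]

end fill

/-! ### The Denert statistic as a sum of place costs -/

section den

variable {N : ℕ} (g L : ℕ) (π : Equiv.Perm (Fin N))

/-- The smallest letter that makes place `j` an excedance place. -/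
def threshold (g L j : ℕ) : ℕ := max (j + g) L

lemma threshold_le_iff {g L j v : ℕ} : threshold g L j ≤ v ↔ j + g ≤ v ∧ L ≤ v := max_le_iff

lemma mem_gExcp (i : Fin N) : i ∈ gExcp g (L + 1) π ↔ threshold g L i ≤ word π i := by
  rw [gExcp, mem_filter, word_val]
  simp only [place, letter, threshold_le_iff, mem_univ, true_and]
  omega

lemma sum_fin_fin (P : ℕ → ℕ → Prop) [∀ i j, Decidable (P i j)] :
    #{p : Fin N × Fin N | P p.1 p.2} = ∑ i ∈ range N, ∑ j ∈ range N, if P i j then 1 else 0 := by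
  rw [card_filter, Fintype.sum_prod_type, ← Fin.sum_univ_eq_sum_range]
  refine sum_congr rfl fun i _ => ?_
  rw [← Fin.sum_univ_eq_sum_range]

lemma invOn_eq (S : Finset (Fin N)) (P : ℕ → Prop) [DecidablePred P] (hS : ∀ i, i ∈ S ↔ P i) :
    invOn π S = ∑ i ∈ range N, ∑ j ∈ range N,
      if i < j ∧ word π j < word π i ∧ P i ∧ P j then 1 else 0 := by
  rw [← sum_fin_fin (fun i j => i < j ∧ word π j < word π i ∧ P i ∧ P j), invOn, invSet,
    filter_filter]
  congr 1
  ext p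
  simp only [mem_filter, mem_univ, hS, word_val, letter, Fin.lt_def, Nat.add_lt_add_iff_right]
  tauto

lemma sum_excedance (F : ℕ → ℕ) : ∑ i ∈ gExcp g (L + 1) π, F i
    = ∑ i ∈ range N, if threshold g L i ≤ word π i then F i else 0 := by
  rw [← Fin.sum_univ_eq_sum_range (fun i => if threshold g L i ≤ word π i then F i else 0),
    ← sum_filter]
  refine sum_congr ?_ fun _ _ => rfl
  ext i
  simp [mem_gExcp]

lemma sum_range_ite_lt {j : ℕ} (hj : j ≤ N) (F : ℕ → ℕ) :
    ∑ i ∈ range j, F i = ∑ i ∈ range N, if i < j then F i else 0 := by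
  rw [← sum_filter]
  refine sum_congr ?_ fun _ _ => rfl
  ext i
  simp only [mem_range, mem_filter]
  omega

/-- The places counted are those `j` with `i < j ≤ word π i - g`; the bound by `L` already holds at
`i`. -/
lemma card_threshold_le {i : ℕ} (hi : i < N) (h : threshold g L i ≤ word π i) :
    g + i + (∑ j ∈ range N, if i < j ∧ threshold g L j ≤ word π i then 1 else 0)
      = word π i := by
  have hw := word_lt π hi
  simp only [threshold_le_iff] at *
  rw [← card_filter, show (range N).filter (fun j => i < j ∧ j + g ≤ word π i ∧ L ≤ word π i)
    = Ico (i + 1) (word π i + 1 - g) by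
      ext j; simp only [mem_filter, mem_range, mem_Ico]; omega, Nat.card_Ico]
  omega

lemma card_inversions_right {i : ℕ} (hi : i < N) :
    (∑ j ∈ range N, if i < j ∧ word π j < word π i then 1 else 0) + i
      = word π i + ∑ j ∈ range N, if j < i ∧ word π i < word π j then 1 else 0 := by
  have h1 : ∑ j ∈ range N, (if word π j < word π i then 1 else 0) = word π i := by
    rw [sum_range_word π fun v => if v < word π i then 1 else 0, ← card_filter,
      show (range N).filter (· < word π i) = range (word π i) by
        have := word_lt π hi
        ext; simp only [mem_filter, mem_range]; omega, card_range]
  have h2 : ∑ j ∈ range N, (if j < i then 1 else 0) = i := by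
    rw [← sum_range_ite_lt hi.le]
    simp
  suffices h : ∑ j ∈ range N, (if i < j ∧ word π j < word π i then 1 else 0)
      + ∑ j ∈ range N, (if j < i then 1 else 0) = ∑ j ∈ range N, (if word π j < word π i then 1 else 0)
        + ∑ j ∈ range N, if j < i ∧ word π i < word π j then 1 else 0 by
    rwa [h1, h2] at h
  rw [← sum_add_distrib, ← sum_add_distrib]
  refine sum_congr rfl fun j _ => ?_
  have : word π i = word π j → i = j := fun h => word_injective π h
  have : i = j → word π i = word π j := fun h => by rw [h]
  split_ifs <;> omega

/-- Double counting: `key` expresses the total cost by all inversions, the excedance places and the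
pairs `i < j` with `threshold g L j ≤ word π i`. The inversions from an excedance to a non-excedance
and these pairs are then both evaluated through the sum of the excedance letters, which drops out.
-/
lemma gden_eq_sum_cost : gden g (L + 1) π = ∑ j ∈ range N, cost (threshold g L) π j := by
  set e : ℕ → Prop := fun i => threshold g L i ≤ word π i with he
  have hN := invOn_eq π (gNexcp g (L + 1) π) (fun i => ¬ e i) (by
    intro i; rw [gNexcp, mem_compl, mem_gExcp])
  have hE := invOn_eq π (gExcp g (L + 1) π) e (mem_gExcp g L π)
  have hs : ∑ i ∈ gExcp g (L + 1) π, (place i + g - 1)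
      = (∑ i ∈ range N, if e i then i else 0) + ∑ i ∈ range N, if e i then g else 0 := by
    rw [← sum_add_distrib, sum_congr rfl (g := fun i : Fin N => (i : ℕ) + g)
      (fun i _ => by simp only [place]; omega), sum_excedance g L π (· + g)]
    refine sum_congr rfl fun i _ => ?_
    split_ifs <;> rfl
  have key : ∑ j ∈ range N, cost (threshold g L) π j
        + ∑ i ∈ range N, ∑ j ∈ range N, (if i < j ∧ threshold g L j ≤ word π i then 1 else 0)
      = ∑ i ∈ range N, ∑ j ∈ range N, (if i < j ∧ word π j < word π i then 1 else 0)
        + ∑ i ∈ range N, if e i then i else 0 := by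
    rw [sum_comm (f := fun i j => if i < j ∧ threshold g L j ≤ word π i then 1 else 0),
      sum_comm (f := fun i j => if i < j ∧ word π j < word π i then 1 else 0),
      ← sum_add_distrib, ← sum_add_distrib]
    refine sum_congr rfl fun j hj => ?_
    have hc := cost_add_below (threshold g L) π j
    have hj' := (mem_range.1 hj).le
    have h1 : below π j (word π j + 1)
        + (∑ i ∈ range N, if i < j ∧ word π j < word π i then 1 else 0) = j := by
      simp only [ite_and]
      rw [← sum_range_ite_lt hj', below, ← sum_add_distrib]
      conv_rhs => rw [← card_range j, card_eq_sum_ones]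
      refine sum_congr rfl fun i _ => ?_
      split_ifs <;> omega
    have h2 : below π j (threshold g L j)
        + (∑ i ∈ range N, if i < j ∧ threshold g L j ≤ word π i then 1 else 0) = j := by
      simp only [ite_and]
      rw [← sum_range_ite_lt hj', below, ← sum_add_distrib]
      conv_rhs => rw [← card_range j, card_eq_sum_ones]
      refine sum_congr rfl fun i _ => ?_
      split_ifs <;> omega
    simp only [he]
    omega
  -- Inversions from a non-excedance to an excedance are missing: a larger letter at an earlier
  -- place than an excedance is itself one.
  have hinv : ∑ i ∈ range N, ∑ j ∈ range N, (if i < j ∧ word π j < word π i then 1 else 0)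
      = ∑ i ∈ range N, ∑ j ∈ range N, (if i < j ∧ word π j < word π i ∧ e i ∧ e j then 1 else 0)
        + (∑ i ∈ range N, ∑ j ∈ range N,
            if i < j ∧ word π j < word π i ∧ ¬ e i ∧ ¬ e j then 1 else 0)
        + ∑ i ∈ range N, ∑ j ∈ range N,
            if i < j ∧ word π j < word π i ∧ e i ∧ ¬ e j then 1 else 0 := by
    simp only [← sum_add_distrib]
    refine sum_congr rfl fun i _ => sum_congr rfl fun j _ => ?_
    have : i < j → word π j < word π i → e j → e i := by
      simp only [he, threshold_le_iff]
      omega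
    by_cases h1 : i < j <;> by_cases h2 : word π j < word π i <;> by_cases h3 : e i <;>
      by_cases h4 : e j <;> simp [h1, h2, h3, h4]
    exact h3 (this h1 h2 h4)
  have hT : ∑ i ∈ range N, (if e i then i else 0) + ∑ i ∈ range N, (if e i then g else 0)
      + ∑ i ∈ range N, ∑ j ∈ range N, (if i < j ∧ threshold g L j ≤ word π i then 1 else 0)
      = ∑ i ∈ range N, if e i then word π i else 0 := by
    simp only [← sum_add_distrib]
    refine sum_congr rfl fun i hi => ?_
    by_cases h : e i
    · have := card_threshold_le g L π (mem_range.1 hi) h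
      simp only [h, if_true]
      omega
    · simp only [h, if_false, zero_add]
      refine sum_eq_zero fun j _ => if_neg ?_
      simp only [he, threshold_le_iff] at h ⊢
      omega
  -- Apply `card_inversions_right` at each excedance: the larger letters to its left are all
  -- excedances, so they form the inversions among excedances, which appear on both sides.
  have hM : ∑ i ∈ range N, ∑ j ∈ range N,
          (if i < j ∧ word π j < word π i ∧ e i ∧ ¬ e j then 1 else 0)
        + ∑ i ∈ range N, ∑ j ∈ range N, (if i < j ∧ word π j < word π i ∧ e i ∧ e j then 1 else 0)
        + ∑ i ∈ range N, (if e i then i else 0)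
      = ∑ i ∈ range N, (if e i then word π i else 0)
        + ∑ i ∈ range N, ∑ j ∈ range N,
          (if i < j ∧ word π j < word π i ∧ e i ∧ e j then 1 else 0) := by
    rw [sum_comm (s := range N) (t := range N)
      (f := fun i j => if i < j ∧ word π j < word π i ∧ e i ∧ e j then 1 else 0)]
    conv_lhs => rw [sum_comm (s := range N) (t := range N)
      (f := fun j i => if i < j ∧ word π j < word π i ∧ e i ∧ e j then 1 else 0)]
    simp only [← sum_add_distrib]
    refine sum_congr rfl fun i hi => ?_
    by_cases h : e i
    · have h1 := card_inversions_right π (mem_range.1 hi)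
      have h2 : ∀ j, (if j < i ∧ word π i < word π j ∧ e j ∧ e i then 1 else 0)
          = if j < i ∧ word π i < word π j then 1 else 0 := by
        intro j
        refine if_congr ?_ rfl rfl
        simp only [he, threshold_le_iff] at h ⊢
        omega
      have h3 : ∀ j, (if i < j ∧ word π j < word π i ∧ e i ∧ ¬ e j then 1 else 0)
            + (if i < j ∧ word π j < word π i ∧ e i ∧ e j then 1 else 0)
          = if i < j ∧ word π j < word π i then 1 else 0 := by
        intro j
        by_cases h4 : e j <;> simp [h, h4]
      simp only [sum_congr rfl fun j _ => h2 j, if_pos h]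
      rw [← sum_congr rfl fun j _ => h3 j] at h1
      omega
    · simp [h]
  rw [gden, hs, hE, hN]
  omega

end den

/-! ### Cyclic raising of letters and the Denert insertion -/

section cycleUp

variable {α : Type*} [LinearOrder α] (C : Finset α)

/-- The next larger element of `C`, or the smallest one if there is none; elements outside `C`
are fixed. -/
def cycleNext (v : α) : α :=
  if hv : v ∈ C then
    if h : (C.filter (v < ·)).Nonempty then (C.filter (v < ·)).min' h else C.min' ⟨v, hv⟩
  else v

variable {C}

lemma cycleNext_of_notMem {v : α} (h : v ∉ C) : cycleNext C v = v := by simp [cycleNext, h]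

lemma cycleNext_mem {v : α} (h : v ∈ C) : cycleNext C v ∈ C := by
  rw [cycleNext, dif_pos h]
  split_ifs with h'
  · exact (mem_filter.1 (min'_mem _ h')).1
  · exact min'_mem _ _

lemma lt_cycleNext {v w : α} (hv : v ∈ C) (hw : w ∈ C) (h : v < w) :
    v < cycleNext C v ∧ cycleNext C v ≤ w := by
  have h' : (C.filter (v < ·)).Nonempty := ⟨w, mem_filter.2 ⟨hw, h⟩⟩
  rw [cycleNext, dif_pos hv, dif_pos h']
  exact ⟨(mem_filter.1 (min'_mem _ h')).2, min'_le _ _ (mem_filter.2 ⟨hw, h⟩)⟩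

lemma cycleNext_le {v w : α} (hv : v ∈ C) (hmax : ∀ u ∈ C, u ≤ v) (hw : w ∈ C) :
    cycleNext C v ≤ w := by
  rw [cycleNext, dif_pos hv, dif_neg]
  · exact min'_le _ _ hw
  · rintro ⟨u, hu⟩
    exact absurd (mem_filter.1 hu).2 (not_lt.2 (hmax u (mem_filter.1 hu).1))

variable (C) in
-- For `v < w` in `C`, the successor of `v` lies in `(v, w]`, while that of `w` is above `w` or, if
-- `w` is the maximum, at most `v`.
lemma cycleNext_injective : Function.Injective (cycleNext C) := by
  intro v w h
  by_cases hv : v ∈ C <;> by_cases hw : w ∈ C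
  · by_contra hne
    wlog hlt : v < w generalizing v w
    · exact this h.symm hw hv (Ne.symm hne) (lt_of_le_of_ne (not_lt.1 hlt) (Ne.symm hne))
    obtain ⟨h1, h2⟩ := lt_cycleNext hv hw hlt
    by_cases hmax : ∀ u ∈ C, u ≤ w
    · have := cycleNext_le hw hmax hv
      rw [← h] at this
      exact absurd h1 (not_lt.2 this)
    · push Not at hmax
      obtain ⟨u, hu, hlt'⟩ := hmax
      have := (lt_cycleNext hw hu hlt').1
      rw [← h] at this
      exact absurd h2 (not_le.2 this)
  · have := cycleNext_mem hv
    rw [h, cycleNext_of_notMem hw] at this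
    exact absurd this hw
  · have := cycleNext_mem hw
    rw [← h, cycleNext_of_notMem hv] at this
    exact absurd this hv
  · rwa [cycleNext_of_notMem hv, cycleNext_of_notMem hw] at h

variable (C) in
/-- The permutation that moves the elements of `C` cyclically upwards. -/
noncomputable def cycleUp [Finite α] : Equiv.Perm α :=
  Equiv.ofBijective (cycleNext C) (Finite.injective_iff_bijective.1 (cycleNext_injective C))

lemma cycleUp_apply [Finite α] (v : α) : cycleUp C v = cycleNext C v := rfl

end cycleUp

lemma word_mul {N : ℕ} (σ τ : Equiv.Perm (Fin N)) (i : ℕ) : word (σ * τ) i = word σ (word τ i) := by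
  rcases lt_or_ge i N with h | h
  · simp [word, h]
  · rw [word_of_le _ h, word_of_le τ h, word_of_le _ h]

/-- The letter `t` of `π` stands in a place `i` such that it stays a large letter of an excedance
when it moves. -/
def TopLetter (g L : ℕ) {N : ℕ} (π : Equiv.Perm (Fin N)) (t : ℕ) : Prop :=
  ∃ i < N, word π i = t ∧ max (i + 1) L + g ≤ t + 1

instance (g L : ℕ) {N : ℕ} (π : Equiv.Perm (Fin N)) : DecidablePred (TopLetter g L π) :=
  fun _ => inferInstanceAs (Decidable (∃ _ < _, _ ∧ _))

/-- The letters that move upwards when a letter is inserted at place `x`. -/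
def InChain (g L : ℕ) {N : ℕ} (π : Equiv.Perm (Fin N)) (x t : ℕ) : Prop :=
  min (x + g - 1) N ≤ t ∧ (t = N ∨ TopLetter g L π t)

instance (g L : ℕ) {N : ℕ} (π : Equiv.Perm (Fin N)) (x : ℕ) : DecidablePred (InChain g L π x) :=
  fun _ => inferInstanceAs (Decidable (_ ∧ _))

/-- The permutation of letters applied when a letter is inserted at place `x`. -/
noncomputable def raise (g L : ℕ) {N : ℕ} (π : Equiv.Perm (Fin N)) (x : ℕ) :
    Equiv.Perm (Fin (N + 1)) :=
  cycleUp {v | InChain g L π x v}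

/-- Insertion of a letter at place `x`. -/
noncomputable def denInsert (g L : ℕ) {N : ℕ} (π : Equiv.Perm (Fin N)) (x : Fin (N + 1)) :
    Equiv.Perm (Fin (N + 1)) :=
  raise g L π x * insertTop π x

section top

variable {g L N : ℕ} {π : Equiv.Perm (Fin N)} {x : ℕ}

lemma topLetter_word {i : ℕ} (hi : i < N) :
    TopLetter g L π (word π i) ↔ i + 1 + g ≤ word π i + 1 ∧ L + g ≤ word π i + 1 := by
  constructor
  · rintro ⟨j, _, h, h'⟩
    obtain rfl := word_injective π h
    omega
  · intro h
    exact ⟨i, hi, rfl, by omega⟩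

lemma TopLetter.lt {t : ℕ} (h : TopLetter g L π t) : t < N := by
  obtain ⟨i, hi, rfl, _⟩ := h
  exact word_lt π hi

lemma word_raise {t : ℕ} (ht : t < N + 1) :
    word (raise g L π x) t = cycleNext ({v | InChain g L π x v} : Finset (Fin (N + 1))) ⟨t, ht⟩ := by
  rw [word, dif_pos ht, raise, cycleUp_apply]

lemma InChain.lt {t : ℕ} (h : InChain g L π x t) : t < N + 1 := by
  rcases h.2 with rfl | h
  · omega
  · exact h.lt.trans (Nat.lt_succ_self _)

lemma word_raise_of_not {t : ℕ} (h : ¬ InChain g L π x t) : word (raise g L π x) t = t := by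
  rcases lt_or_ge t (N + 1) with ht | ht
  · rw [word_raise ht, cycleNext_of_notMem (by simpa using h)]
  · exact word_of_le _ ht

lemma InChain.word_raise {t : ℕ} (h : InChain g L π x t) :
    InChain g L π x (word (raise g L π x) t) := by
  rw [_root_.word_raise h.lt]
  have := cycleNext_mem (C := ({v | InChain g L π x v} : Finset (Fin (N + 1)))) (v := ⟨t, h.lt⟩)
    (by simpa using h)
  simpa using this

lemma InChain.lt_word_raise {t u : ℕ} (ht : InChain g L π x t) (hu : InChain g L π x u)
    (h : t < u) : t < word (raise g L π x) t ∧ word (raise g L π x) t ≤ u := by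
  rw [_root_.word_raise ht.lt]
  exact lt_cycleNext (C := ({v | InChain g L π x v} : Finset (Fin (N + 1)))) (v := ⟨t, ht.lt⟩)
    (w := ⟨u, hu.lt⟩) (by simpa using ht) (by simpa using hu) h

lemma inChain_self : InChain g L π x N := ⟨by omega, Or.inl rfl⟩

lemma InChain.top_le {t : ℕ} (ht : InChain g L π x t) : word (raise g L π x) N ≤ t := by
  rw [_root_.word_raise (Nat.lt_succ_self N)]
  refine cycleNext_le (C := ({v | InChain g L π x v} : Finset (Fin (N + 1))))
    (v := ⟨N, Nat.lt_succ_self N⟩) (w := ⟨t, ht.lt⟩) (by simpa using inChain_self) (fun u _ => ?_)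
    (by simpa using ht)
  simp only [Fin.le_def]
  omega

lemma le_word_raise {t : ℕ} (ht : t < N) : t ≤ word (raise g L π x) t := by
  by_cases h : InChain g L π x t
  · exact (h.lt_word_raise inChain_self ht).1.le
  · rw [word_raise_of_not h]

/-- Above any chain element every top letter is again in the chain, so the successor of `t` is at
most `u`, and `u` itself moves strictly up. -/
lemma word_raise_lt {t u : ℕ} (hu : TopLetter g L π u) (h : t < u) :
    word (raise g L π x) t < word (raise g L π x) u := by
  by_cases hC : InChain g L π x t
  · have hCu : InChain g L π x u := ⟨hC.1.trans h.le, Or.inr hu⟩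
    exact (hC.lt_word_raise hCu h).2.trans_lt (hCu.lt_word_raise inChain_self hu.lt).1
  · rw [word_raise_of_not hC]
    exact h.trans_le (le_word_raise hu.lt)

lemma word_denInsert_of_lt {i : ℕ} (hx : x < N + 1) (h : i < x) :
    word (denInsert g L π ⟨x, hx⟩) i = word (raise g L π x) (word π i) := by
  rw [denInsert, word_mul, word_insertTop_of_lt _ _ h]

lemma word_denInsert_self (hx : x < N + 1) :
    word (denInsert g L π ⟨x, hx⟩) x = word (raise g L π x) N := by
  rw [denInsert, word_mul, word_insertTop_self]

lemma word_denInsert_succ {i : ℕ} (hx : x < N + 1) (h : x ≤ i) (hi : i < N) :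
    word (denInsert g L π ⟨x, hx⟩) (i + 1) = word (raise g L π x) (word π i) := by
  rw [denInsert, word_mul, word_insertTop_succ _ _ h hi]

end top

/-- The place `j` is special if the letter `j + g` is a top or lies beyond the alphabet. -/
def DenSpecial (g L : ℕ) {N : ℕ} (π : Equiv.Perm (Fin N)) (j : ℕ) : Prop :=
  TopLetter g L π (j + g) ∨ N ≤ j + g

instance (g L : ℕ) {N : ℕ} (π : Equiv.Perm (Fin N)) : DecidablePred (DenSpecial g L π) :=
  fun _ => inferInstanceAs (Decidable (_ ∨ _))

lemma threshold_of_le {g L j : ℕ} (h : L ≤ j) : threshold g L j = j + g := by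
  rw [threshold]
  omega

lemma below_add_sum {N : ℕ} (π : Equiv.Perm (Fin N)) {j : ℕ} (hj : j ≤ N) (t : ℕ) :
    below π j t + ∑ i ∈ Ico j N, (if word π i < t then 1 else 0) = min t N := by
  rw [below, range_eq_Ico, sum_Ico_consecutive _ (Nat.zero_le j) hj, ← range_eq_Ico,
    sum_range_word π fun v => if v < t then 1 else 0, ← card_filter,
    show (range N).filter (· < t) = range (min t N) by
      ext; simp only [mem_filter, mem_range]; omega, card_range]

section denInsert

variable {g L N : ℕ} (π : Equiv.Perm (Fin N)) {x : ℕ}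

/-- Letters below `j + g` do not move. The others in places up to `j` are top letters, which stay
above the threshold and keep their order. -/
lemma cost_denInsert_of_lt (hx : x < N + 1) {j : ℕ} (hL : L ≤ j) (hj : j < x) :
    cost (threshold g L) (denInsert g L π ⟨x, hx⟩) j = cost (threshold g L) π j := by
  have hsmall : ∀ t < N, t < j + g → word (raise g L π x) t = t := fun t ht h =>
    word_raise_of_not fun hC => by have := hC.1; omega
  have htop : ∀ i ≤ j, j + g ≤ word π i → TopLetter g L π (word π i) := fun i hi h =>
    (topLetter_word (by omega)).2 (by omega)
  refine sum_congr rfl fun i hi => if_congr ?_ rfl rfl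
  have hij := mem_range.1 hi
  rw [threshold_of_le hL, word_denInsert_of_lt hx hj, word_denInsert_of_lt hx (by omega),
    cycBetween_iff, cycBetween_iff]
  have hu := word_lt π (by omega : i < N)
  have hv := word_lt π (by omega : j < N)
  have hu1 := hsmall _ hu
  have hv1 := hsmall _ hv
  have hu2 := htop i (by omega)
  have hv2 := htop j le_rfl
  have hu3 := le_word_raise (g := g) (L := L) (π := π) (x := x) hu
  have hv3 := le_word_raise (g := g) (L := L) (π := π) (x := x) hv
  have hne : word π i ≠ word π j := fun h => hij.ne (word_injective π h)
  rcases lt_or_ge (word π i) (j + g) with h1 | h1 <;>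
    rcases lt_or_ge (word π j) (j + g) with h2 | h2
  · rw [hu1 h1, hv1 h2]
  · rw [hu1 h1]
    omega
  · rw [hv1 h2]
    omega
  · rcases lt_or_gt_of_ne hne with h | h
    · have := word_raise_lt (x := x) (hv2 h2) h
      omega
    · have := word_raise_lt (x := x) (hu2 h1) h
      omega

lemma inChain_word_iff (hg : 1 ≤ g) {i : ℕ} (hL : L ≤ i) (hx : x ≤ i) (hi : i < N) :
    InChain g L π x (word π i) ↔ i + g ≤ word π i := by
  have := word_lt π hi
  rw [InChain, topLetter_word hi]
  omega

lemma below_denInsert_succ (hx : x < N + 1) {j : ℕ} (hxj : x ≤ j) (hj : j < N) (t : ℕ) :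
    below (denInsert g L π ⟨x, hx⟩) (j + 1) t
      = (∑ i ∈ range j, if word (raise g L π x) (word π i) < t then 1 else 0)
        + if word (raise g L π x) N < t then 1 else 0 := by
  rw [below, sum_range_succ_split hxj, word_denInsert_self]
  have h1 : ∀ i ∈ range x, (if word (denInsert g L π ⟨x, hx⟩) i < t then 1 else 0)
      = if word (raise g L π x) (word π i) < t then 1 else 0 := fun i hi => by
    rw [word_denInsert_of_lt hx (mem_range.1 hi)]
  have h2 : ∀ i ∈ Ico x j, (if word (denInsert g L π ⟨x, hx⟩) (i + 1) < t then 1 else 0)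
      = if word (raise g L π x) (word π i) < t then 1 else 0 := fun i hi => by
    rw [word_denInsert_succ hx (mem_Ico.1 hi).1 (by have := (mem_Ico.1 hi).2; omega)]
  rw [sum_congr rfl h1, sum_congr rfl h2, range_eq_Ico, range_eq_Ico,
    ← sum_Ico_consecutive _ (Nat.zero_le x) hxj]
  ring

lemma below_denInsert_add_sum (hx : x < N + 1) {j : ℕ} (hxj : x ≤ j) (hj : j < N) (t : ℕ) :
    below (denInsert g L π ⟨x, hx⟩) (j + 1) t
      + ∑ i ∈ Ico j N, (if word (raise g L π x) (word π i) < t then 1 else 0) = min t (N + 1) := by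
  rw [← below_add_sum (denInsert g L π ⟨x, hx⟩) (by omega : j + 1 ≤ N + 1), ← sum_Ico_add']
  congr 1
  refine sum_congr rfl fun i hi => ?_
  obtain ⟨h1, h2⟩ := mem_Ico.1 hi
  rw [word_denInsert_succ hx (by omega) h2]

/-- An excedance letter keeps its comparisons with the earlier letters, and the new letter at `x`,
the least of the chain, is at most its raised value. A non-excedance letter does not move, so here
the smaller letters to its right are counted instead. -/
lemma below_denInsert_word (hg : 1 ≤ g) (hx : x < N + 1) {j : ℕ} (hL : L ≤ j) (hxj : x ≤ j)
    (hj : j < N) :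
    below (denInsert g L π ⟨x, hx⟩) (j + 1) (word (raise g L π x) (word π j) + 1)
      = below π j (word π j + 1) + if j + g ≤ word π j then 1 else 0 := by
  have hC := inChain_word_iff π hg hL hxj hj
  have hv := word_lt π hj
  by_cases h : j + g ≤ word π j
  · have hCj := hC.2 h
    have hTj : TopLetter g L π (word π j) := (topLetter_word hj).2 (by omega)
    rw [below_denInsert_succ π hx hxj hj, if_pos (Nat.lt_succ_of_le hCj.word_raise.top_le),
      if_pos h, below]
    congr 1
    refine sum_congr rfl fun i hi => if_congr ?_ rfl rfl
    have hij := mem_range.1 hi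
    have hu := word_lt π (by omega : i < N)
    have hne : word π i ≠ word π j := fun h => hij.ne (word_injective π h)
    have htop := topLetter_word (g := g) (L := L) (π := π) (by omega : i < N)
    have hvr := (hCj.lt_word_raise inChain_self hv).1
    by_cases hT : TopLetter g L π (word π i)
    · rcases lt_or_gt_of_ne hne with h' | h'
      · have := word_raise_lt (x := x) hTj h'
        omega
      · have := word_raise_lt (x := x) hT h'
        omega
    · rw [word_raise_of_not (fun h => hT (h.2.resolve_left hu.ne))]
      rw [htop] at hT
      omega
  · rw [if_neg h, word_raise_of_not (fun h' => h (hC.1 h')), add_zero]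
    have h1 := below_denInsert_add_sum (g := g) (L := L) π hx hxj hj (word π j + 1)
    have h2 := below_add_sum π hj.le (word π j + 1)
    have h3 : ∀ i ∈ Ico j N, (if word (raise g L π x) (word π i) < word π j + 1 then 1 else 0)
        = if word π i < word π j + 1 then 1 else 0 := by
      intro i hi
      obtain ⟨hji, hi⟩ := mem_Ico.1 hi
      have hCi := inChain_word_iff (x := x) π hg (by omega : L ≤ i) (by omega) hi
      have hu := word_lt π hi
      by_cases h' : InChain g L π x (word π i)
      · have := hCi.1 h'
        have := (h'.lt_word_raise inChain_self hu).1
        rw [if_neg (by omega), if_neg (by omega)]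
      · rw [word_raise_of_not h']
    rw [sum_congr rfl h3] at h1
    omega

lemma sum_word_eq (t : ℕ) : (∑ i ∈ range N, if word π i = t then 1 else 0)
    = if t < N then 1 else 0 := by
  rw [sum_range_word π fun v => if v = t then 1 else 0]
  simp

/-- Counted through the complement to the right of `j`. Both the total and the threshold rise by
one; the right side gains only the letter `j + g`, and only if it is in the alphabet and not top, in
which case it stands at or after place `j`. -/
lemma below_denInsert_threshold (hg : 1 ≤ g) (hx : x < N + 1) {j : ℕ} (hL : L ≤ j) (hxj : x ≤ j)
    (hj : j < N) :
    below (denInsert g L π ⟨x, hx⟩) (j + 1) (j + 1 + g)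
      = below π j (j + g) + if DenSpecial g L π j then 1 else 0 := by
  have h1 := below_denInsert_add_sum (g := g) (L := L) π hx hxj hj (j + 1 + g)
  have h2 := below_add_sum π hj.le (j + g)
  have h3 : ∀ i ∈ Ico j N, (if word (raise g L π x) (word π i) < j + 1 + g then 1 else 0)
      = (if word π i < j + g then 1 else 0)
        + if word π i = j + g ∧ ¬ TopLetter g L π (j + g) then 1 else 0 := by
    intro i hi
    obtain ⟨hji, hi⟩ := mem_Ico.1 hi
    have hCi := inChain_word_iff (x := x) π hg (by omega : L ≤ i) (by omega) hi
    have hu := word_lt π hi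
    have htop := topLetter_word (g := g) (L := L) (π := π) hi
    by_cases h' : InChain g L π x (word π i)
    · have := hCi.1 h'
      have := (h'.lt_word_raise inChain_self hu).1
      have hT := h'.2.resolve_left hu.ne
      rw [if_neg (by omega), if_neg (by omega), if_neg]
      rintro ⟨h4, h5⟩
      exact h5 (h4 ▸ hT)
    · have := mt hCi.2 h'
      rw [word_raise_of_not h']
      rcases eq_or_ne (word π i) (j + g) with h4 | h4
      · have : ¬ TopLetter g L π (word π i) := by
          rw [htop]
          omega
        rw [if_pos (by omega), if_neg (by omega), if_pos ⟨h4, h4 ▸ this⟩]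
      · rw [if_neg (c := _ ∧ _) (fun h => h4 h.1), add_zero]
        exact if_congr (by omega) rfl rfl
  have h4 : ∑ i ∈ Ico j N, (if word π i = j + g ∧ ¬ TopLetter g L π (j + g) then 1 else 0)
      = if j + g < N ∧ ¬ TopLetter g L π (j + g) then 1 else 0 := by
    by_cases hT : TopLetter g L π (j + g)
    · simp [hT]
    · have h5 := sum_word_eq π (j + g)
      rw [range_eq_Ico, ← sum_Ico_consecutive _ (Nat.zero_le j) hj.le,
        sum_eq_zero (s := Ico 0 j) (fun i hi => if_neg (fun h => hT ?_)), zero_add] at h5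
      · simp only [hT, not_false_eq_true, and_true]
        exact h5
      · have := (mem_Ico.1 hi).2
        rw [← h]
        exact (topLetter_word (by omega)).2 (by omega)
  rw [sum_congr rfl h3, sum_add_distrib, h4] at h1
  by_cases hT : TopLetter g L π (j + g)
  · have := hT.lt
    rw [if_pos (show DenSpecial g L π j from Or.inl hT)]
    rw [if_neg (fun h => h.2 hT)] at h1
    omega
  · rcases lt_or_ge (j + g) N with h5 | h5
    · rw [if_neg (fun h => h.elim hT (by omega))]
      rw [if_pos ⟨h5, hT⟩] at h1
      omega
    · rw [if_pos (show DenSpecial g L π j from Or.inr h5)]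
      rw [if_neg (fun h => by omega)] at h1
      omega

lemma excedance_denInsert_succ (hg : 1 ≤ g) (hx : x < N + 1) {j : ℕ} (hL : L ≤ j) (hxj : x ≤ j)
    (hj : j < N) :
    j + 1 + g ≤ word (denInsert g L π ⟨x, hx⟩) (j + 1) ↔ j + g ≤ word π j := by
  rw [word_denInsert_succ hx hxj hj]
  have hC := inChain_word_iff π hg hL hxj hj
  by_cases h' : InChain g L π x (word π j)
  · have := (h'.lt_word_raise inChain_self (word_lt π hj)).1
    have := hC.1 h'
    omega
  · have := mt hC.2 h'
    rw [word_raise_of_not h']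
    omega

/-- In `cost_add_below`, the extra smaller letter of an excedance cancels against the increase of
the place from `j` to `j + 1`; only the change at the threshold remains. -/
lemma cost_denInsert_succ (hg : 1 ≤ g) (hx : x < N + 1) {j : ℕ} (hL : L ≤ j) (hxj : x ≤ j)
    (hj : j < N) :
    cost (threshold g L) (denInsert g L π ⟨x, hx⟩) (j + 1)
      = cost (threshold g L) π j + if DenSpecial g L π j then 1 else 0 := by
  have h1 := cost_add_below (threshold g L) (denInsert g L π ⟨x, hx⟩) (j + 1)
  have h2 := cost_add_below (threshold g L) π j
  rw [threshold_of_le (by omega), below_denInsert_threshold π hg hx hL hxj hj] at h1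
  simp only [excedance_denInsert_succ π hg hx hL hxj hj] at h1
  rw [word_denInsert_succ hx hxj hj, below_denInsert_word π hg hx hL hxj hj] at h1
  rw [threshold_of_le hL] at h2
  split_ifs at * <;> omega

lemma raise_top_of_special (h : InChain g L π x (min (x + g - 1) N)) :
    word (raise g L π x) N = min (x + g - 1) N :=
  le_antisymm h.top_le inChain_self.word_raise.1

lemma lt_raise_top_of_not_special (h : ¬ InChain g L π x (min (x + g - 1) N)) :
    min (x + g - 1) N < word (raise g L π x) N := by
  refine lt_of_le_of_ne inChain_self.word_raise.1 fun h' => h ?_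
  rw [h']
  exact inChain_self.word_raise

lemma inChain_min_iff (hg : 1 ≤ g) (hx0 : 1 ≤ x) :
    InChain g L π x (min (x + g - 1) N) ↔ DenSpecial g L π (x - 1) := by
  rw [InChain, DenSpecial, show x - 1 + g = x + g - 1 by omega]
  rcases lt_or_ge (x + g - 1) N with h | h
  · rw [min_eq_left h.le]
    simp [h.ne, not_le.2 h]
  · rw [min_eq_right h]
    simp [h]

/-- In the first case place `x` receives `min (x + g - 1) N`, and no letter lies between this and
the threshold. Otherwise it receives an excedance letter, least in the chain: earlier letters in the
chain are larger, and all other earlier letters are below the threshold, so all `x` of them count.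
-/
lemma cost_denInsert_self (hg : 1 ≤ g) (hx : x < N + 1) (hL : L ≤ x) :
    cost (threshold g L) (denInsert g L π ⟨x, hx⟩) x
      = if InChain g L π x (min (x + g - 1) N) then 0 else x := by
  rw [cost, threshold_of_le hL, word_denInsert_self]
  split_ifs with h
  · rw [raise_top_of_special π h]
    refine sum_eq_zero fun i hi => if_neg ?_
    have hi' := mem_range.1 hi
    rw [word_denInsert_of_lt hx hi', cycBetween_iff]
    have := word_lt (raise g L π x) (Nat.lt_succ_of_lt (word_lt π (by omega : i < N)))
    omega
  · have h' := lt_raise_top_of_not_special π h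
    have hN : x + g - 1 < N := by
      by_contra hN
      rw [min_eq_right (by omega)] at h
      exact h inChain_self
    conv_rhs => rw [← card_range x, card_eq_sum_ones]
    refine sum_congr rfl fun i hi => if_pos ?_
    have hi' := mem_range.1 hi
    have hu := word_lt π (by omega : i < N)
    rw [word_denInsert_of_lt hx hi', cycBetween_iff]
    refine Or.inr ⟨by omega, ?_⟩
    by_cases hC : InChain g L π x (word π i)
    · left
      refine lt_of_le_of_ne hC.word_raise.top_le fun he => hu.ne ?_
      exact (word_injective _ he).symm
    · right
      rw [word_raise_of_not hC]
      rw [InChain, topLetter_word (by omega)] at hC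
      omega

lemma excedance_denInsert_self (hg : 1 ≤ g) (hx : x < N + 1) :
    x + g ≤ word (denInsert g L π ⟨x, hx⟩) x ↔ ¬ InChain g L π x (min (x + g - 1) N) := by
  rw [word_denInsert_self]
  have hlt := word_lt (raise g L π x) (Nat.lt_succ_self N)
  by_cases h : InChain g L π x (min (x + g - 1) N)
  · rw [raise_top_of_special π h]
    simp only [h, not_true, iff_false]
    omega
  · have := lt_raise_top_of_not_special π h
    simp only [h, not_false_eq_true, iff_true]
    omega

lemma excedance_denInsert_of_lt (hg : 1 ≤ g) (hx : x < N + 1) {j : ℕ} (hj : j < x) :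
    j + g ≤ word (denInsert g L π ⟨x, hx⟩) j ↔ j + g ≤ word π j := by
  rw [word_denInsert_of_lt hx hj]
  have hu := word_lt π (by omega : j < N)
  have := le_word_raise (g := g) (L := L) (π := π) (x := x) hu
  by_cases h : InChain g L π x (word π j)
  · have := h.1
    omega
  · rw [word_raise_of_not h]

end denInsert

/-! ### High statistics under extension -/

/-- The contribution of the places `j ≥ L` to the Denert statistic. -/
def highCost (g L : ℕ) {N : ℕ} (π : Equiv.Perm (Fin N)) : ℕ :=
  ∑ j ∈ Ico L N, cost (threshold g L) π j

/-- The number of excedance places `j ≥ L`. -/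
def highExc (g L : ℕ) {N : ℕ} (π : Equiv.Perm (Fin N)) : ℕ :=
  ∑ j ∈ Ico L N, if j + g ≤ word π j then 1 else 0

lemma gexc_eq_highExc (g L : ℕ) {N : ℕ} (π : Equiv.Perm (Fin N)) :
    gexc g (L + 1) π = highExc g L π := by
  rw [highExc, show Ico L N = (range N).filter (L ≤ ·) by ext; simp [and_comm], sum_filter,
    ← Fin.sum_univ_eq_sum_range (fun j => if L ≤ j then if j + g ≤ word π j then 1 else 0 else 0),
    gexc, card_filter]
  refine sum_congr rfl fun i _ => ?_
  rw [← ite_and]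
  refine if_congr ?_ rfl rfl
  rw [word_val]
  simp only [place, letter]
  omega

lemma sum_Ico_succ_split {L N x : ℕ} (hL : L ≤ x) (hx : x ≤ N) (F : ℕ → ℕ) :
    ∑ i ∈ Ico L (N + 1), F i = ∑ i ∈ Ico L x, F i + (F x + ∑ i ∈ Ico x N, F (i + 1)) := by
  rw [← sum_Ico_consecutive _ hL (show x ≤ N + 1 by omega),
    sum_eq_sum_Ico_succ_bot (by omega : x < N + 1), sum_Ico_add']

section stats

variable {g N : ℕ} {l : Fin (N + 1)} (π : Equiv.Perm (Fin N))

lemma highCost_denInsert (hg : 1 ≤ g) {x : Fin (N + 1)} (hx : l ≤ x) :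
    highCost g l (denInsert g l π x) = highCost g l π
      + countFrom N (DenSpecial g l π) x
      + if InChain g l π x (min (x + g - 1) N) then 0 else (x : ℕ) := by
  have hL : (l : ℕ) ≤ x := hx
  obtain ⟨x, hxN⟩ := x
  simp only at *
  rw [highCost, sum_Ico_succ_split hL (by omega), cost_denInsert_self π hg hxN hL, highCost,
    ← sum_Ico_consecutive _ hL (by omega : x ≤ N), countFrom]
  have h1 : ∀ j ∈ Ico (l : ℕ) x, cost (threshold g l) (denInsert g l π ⟨x, hxN⟩) j
      = cost (threshold g l) π j := fun j hj =>
    cost_denInsert_of_lt π hxN (mem_Ico.1 hj).1 (mem_Ico.1 hj).2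
  have h2 : ∀ j ∈ Ico x N, cost (threshold g l) (denInsert g l π ⟨x, hxN⟩) (j + 1)
      = cost (threshold g l) π j + if DenSpecial g l π j then 1 else 0 := fun j hj =>
    cost_denInsert_succ π hg hxN (hL.trans (mem_Ico.1 hj).1) (mem_Ico.1 hj).1 (mem_Ico.1 hj).2
  rw [sum_congr rfl h1, sum_congr rfl h2, sum_add_distrib]
  ring

lemma highExc_denInsert (hg : 1 ≤ g) {x : Fin (N + 1)} (hx : l ≤ x) :
    highExc g l (denInsert g l π x) = highExc g l π
      + if InChain g l π x (min (x + g - 1) N) then 0 else 1 := by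
  have hL : (l : ℕ) ≤ x := hx
  obtain ⟨x, hxN⟩ := x
  simp only at *
  rw [highExc, sum_Ico_succ_split hL (by omega), highExc,
    ← sum_Ico_consecutive _ hL (by omega : x ≤ N)]
  have h1 : ∀ j ∈ Ico (l : ℕ) x, (if j + g ≤ word (denInsert g l π ⟨x, hxN⟩) j then 1 else 0)
      = if j + g ≤ word π j then 1 else 0 := fun j hj =>
    if_congr (excedance_denInsert_of_lt π hg hxN (mem_Ico.1 hj).2) rfl rfl
  have h2 : ∀ j ∈ Ico x N, (if j + 1 + g ≤ word (denInsert g l π ⟨x, hxN⟩) (j + 1) then 1 else 0)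
      = if j + g ≤ word π j then 1 else 0 := fun j hj =>
    if_congr (excedance_denInsert_succ π hg hxN (hL.trans (mem_Ico.1 hj).1) (mem_Ico.1 hj).1
      (mem_Ico.1 hj).2) rfl rfl
  rw [sum_congr rfl h1, sum_congr rfl h2,
    if_congr (excedance_denInsert_self (L := l) π hg hxN) rfl rfl, ite_not]
  ring

/-- The cyclic rank of the letter in place `x` among the letters in the places up to `l`, after
insertion at `l`. -/
noncomputable def lowRank (g : ℕ) {N : ℕ} (l : Fin (N + 1)) (π : Equiv.Perm (Fin N)) (x : ℕ) : ℕ :=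
  #{i ∈ range (l + 1) | CycBetween (threshold g l l) (word (denInsert g l π l) x)
    (word (denInsert g l π l) i)}

lemma lowRank_le {g N : ℕ} (l : Fin (N + 1)) (π : Equiv.Perm (Fin N)) {x : ℕ} (hx : x ≤ l) :
    lowRank g l π x ≤ l := by
  have := card_cycBetween_lt_card (w := word (denInsert g l π l)) (T := threshold g l l)
    (mem_range.2 (by omega : x < l + 1))
  rw [card_range] at this
  exact Nat.le_of_lt_succ this

/-- Insertion at `x` for `x ≥ l`; for `x < l` the letter is inserted at `l` and then exchanged
with that in place `x`. -/
noncomputable def denExtend (g : ℕ) {N : ℕ} (l : Fin (N + 1))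
    (p : Equiv.Perm (Fin N) × Fin (N + 1)) : Equiv.Perm (Fin (N + 1)) :=
  denInsert g l p.1 (max p.2 l) * Equiv.swap (min p.2 l) l

lemma denExtend_of_le {x : Fin (N + 1)} (hx : l ≤ x) :
    denExtend g l (π, x) = denInsert g l π x := by
  simp [denExtend, hx, ← Equiv.Perm.one_def]

lemma denExtend_of_ge {x : Fin (N + 1)} (hx : x ≤ l) :
    denExtend g l (π, x) = denInsert g l π l * Equiv.swap x l := by
  simp [denExtend, hx]

lemma sum_Ico_mul_swap (σ : Equiv.Perm (Fin (N + 1))) {x : Fin (N + 1)} (hx : x ≤ l) :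
    ∑ j ∈ Ico ((l : ℕ) + 1) (N + 1), cost (threshold g l) (σ * Equiv.swap x l) j
      = ∑ j ∈ Ico ((l : ℕ) + 1) (N + 1), cost (threshold g l) σ j := by
  refine sum_congr rfl fun j hj => ?_
  have h1 : (x : ℕ) ≤ l := hx
  have := (mem_Ico.1 hj).1
  exact cost_mul_swap_of_lt _ _ (by omega) (by omega)

/-- For `x ≤ l`, the places beyond `l` contribute the old value plus `countFrom N (DenSpecial g l π)
l`, whatever is exchanged; only the cost at `l` varies, and it becomes the rank of the letter
brought there. -/
lemma highCost_denExtend (hg : 1 ≤ g) (x : Fin (N + 1)) :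
    highCost g l (denExtend g l (π, x))
      = highCost g l π + slotLabel N l (DenSpecial g l π) (lowRank g l π) x := by
  rcases le_or_gt x l with hx | hx
  · have hx' : (x : ℕ) ≤ l := hx
    have h1 := highCost_denInsert π hg (le_refl l)
    have h2 := cost_denInsert_self (L := l) π hg l.2 le_rfl
    rw [highCost, sum_eq_sum_Ico_succ_bot l.2, h2] at h1
    rw [denExtend_of_ge π hx, highCost, sum_eq_sum_Ico_succ_bot l.2, sum_Ico_mul_swap _ hx,
      cost_mul_swap_self _ _ hx, slotLabel, if_pos hx', lowRank]
    omega
  · have hx' : (l : ℕ) < x := hx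
    rw [denExtend_of_le π hx.le, highCost_denInsert π hg hx.le, slotLabel,
      if_neg (by omega : ¬ (x : ℕ) ≤ l), if_congr (inChain_min_iff π hg (by omega)) rfl rfl,
      add_assoc]

lemma sum_word_fin (F : ℕ → ℕ) (t : ℕ) (ht : t < N) :
    (∑ i ∈ range N, if word π i = t then F (word π i) else 0) = F t := by
  rw [sum_range_word π fun v => if v = t then F v else 0]
  simp [ht]

/-- Shift by `g`: of the letters `t` from `l + g` to `N + g - 1`, the last `g` lie beyond the
alphabet, and the top letters among the rest stand either at a high excedance or at a low place. -/
lemma countFrom_denSpecial (hg : 1 ≤ g) (hN : g + l ≤ N) :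
    countFrom N (DenSpecial g l π) l
      = g + highExc g l π + ∑ i ∈ range l, if l + g ≤ word π i then 1 else 0 := by
  have h1 : countFrom N (DenSpecial g l π) l
      = ∑ t ∈ Ico (l + g) (N + g), if TopLetter g l π t ∨ N ≤ t then 1 else 0 := by
    rw [countFrom, ← sum_Ico_add' (fun t => if TopLetter g l π t ∨ N ≤ t then 1 else 0)]
    rfl
  have h2 : ∀ t ∈ Ico N (N + g), (if TopLetter g l π t ∨ N ≤ t then 1 else 0) = 1 := fun t ht =>
    if_pos (Or.inr (mem_Ico.1 ht).1)
  have h3 : ∀ t ∈ Ico (l + g) N, (if TopLetter g l π t ∨ N ≤ t then 1 else 0)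
      = if TopLetter g l π t then 1 else 0 := fun t ht => by
    have := (mem_Ico.1 ht).2
    exact if_congr (or_iff_left (by omega)) rfl rfl
  have h4 : Ico (l + g) N = (range N).filter (l + g ≤ ·) := by
    ext
    simp [and_comm]
  rw [h1, ← sum_Ico_consecutive _ (by omega : l + g ≤ N) (by omega : N ≤ N + g),
    sum_congr rfl h2, sum_congr rfl h3, h4, sum_filter,
    ← sum_range_word π fun t => if l + g ≤ t then if TopLetter g l π t then 1 else 0 else 0,
    range_eq_Ico, ← sum_Ico_consecutive _ (Nat.zero_le l) (by omega : (l : ℕ) ≤ N),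
    ← range_eq_Ico, highExc]
  have h5 : ∀ i ∈ range l, (if l + g ≤ word π i then if TopLetter g l π (word π i) then 1 else 0
      else 0) = if l + g ≤ word π i then 1 else 0 := fun i hi => by
    have := mem_range.1 hi
    rw [← ite_and]
    refine if_congr ?_ rfl rfl
    rw [topLetter_word (by omega)]
    omega
  have h6 : ∀ i ∈ Ico (l : ℕ) N, (if l + g ≤ word π i then
      if TopLetter g l π (word π i) then 1 else 0 else 0)
        = if i + g ≤ word π i then 1 else 0 := fun i hi => by
    obtain ⟨h, h'⟩ := mem_Ico.1 hi
    rw [← ite_and]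
    refine if_congr ?_ rfl rfl
    rw [topLetter_word h']
    omega
  rw [sum_congr rfl h5, sum_congr rfl h6]
  simp
  ring

/-- A low letter crosses the threshold only if it equals `l + g - 1`. Precisely when such a letter
exists, place `l` receives `l + g - 1` in exchange, which restores the count. -/
lemma card_low (hg : 1 ≤ g) (hN : g + l ≤ N) :
    #{i ∈ range (l + 1) | word (denInsert g l π l) i < threshold g l l}
      + (∑ i ∈ range l, if l + g ≤ word π i then 1 else 0) = l := by
  have hw : ∀ i ∈ range l, (if word (denInsert g l π l) i < threshold g l l then 1 else 0)
      + (if l + g ≤ word π i then 1 else 0) + (if word π i = l + g - 1 then 1 else 0) = 1 := by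
    intro i hi
    have hil := mem_range.1 hi
    have hlt := word_lt π (by omega : i < N)
    rw [threshold_of_le le_rfl, word_denInsert_of_lt l.2 hil]
    by_cases h : InChain g l π l (word π i)
    · have h1 := (h.lt_word_raise inChain_self hlt).1
      have h2 := h.1
      split_ifs <;> omega
    · rw [word_raise_of_not h]
      rw [InChain, topLetter_word (by omega)] at h
      split_ifs <;> omega
  have h1 : (∑ i ∈ range l, if word π i = l + g - 1 then 1 else 0)
      = if TopLetter g l π (l + g - 1) then 1 else 0 := by
    have h2 := sum_word_fin π (fun t => if TopLetter g l π t then 1 else 0) (l + g - 1) (by omega)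
    rw [← h2, range_eq_Ico, range_eq_Ico,
      ← sum_Ico_consecutive _ (Nat.zero_le l) (by omega : (l : ℕ) ≤ N),
      sum_eq_zero (s := Ico (l : ℕ) N), add_zero]
    · refine sum_congr rfl fun i hi => ?_
      have := mem_Ico.1 hi
      by_cases h : word π i = l + g - 1
      · rw [if_pos h, if_pos h, if_pos]
        exact (topLetter_word (by omega)).2 (by omega)
      · rw [if_neg h, if_neg h]
    · intro i hi
      obtain ⟨h3, h4⟩ := mem_Ico.1 hi
      rw [← ite_and]
      refine if_neg ?_
      rw [topLetter_word h4]
      omega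
  have hself := excedance_denInsert_self (L := l) π hg l.2
  have hC : InChain g l π l (min (l + g - 1) N) ↔ TopLetter g l π (l + g - 1) := by
    rw [InChain, min_eq_left (by omega)]
    constructor
    · rintro ⟨_, h | h⟩
      · omega
      · exact h
    · exact fun h => ⟨le_rfl, Or.inr h⟩
  have hsum := sum_congr rfl hw
  rw [sum_add_distrib, sum_add_distrib, h1, sum_const, card_range, smul_eq_mul, mul_one] at hsum
  have htop : word (denInsert g l π l) l < threshold g l l ↔ TopLetter g l π (l + g - 1) := by
    rw [← hC, threshold_of_le le_rfl, ← not_le]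
    exact not_iff_comm.1 hself.symm
  rw [card_filter, sum_range_succ, if_congr htop rfl rfl]
  omega

/-- By `countFrom_denSpecial` and `card_low`, the special places from `l` on and the letters below
the threshold in places up to `l` number `highExc g l π + (g + l)` together. A label for `x ≤ l`
therefore reaches this bound exactly if the letter brought to `l` is an excedance. -/
lemma highExc_denExtend (hg : 1 ≤ g) (x : Fin (N + 1)) :
    highExc g l (denExtend g l (π, x)) = highExc g l π
      + if highExc g l π + (g + l) ≤ slotLabel N l (DenSpecial g l π) (lowRank g l π) x
        then 1 else 0 := by
  have hρ : ∀ y ≤ (l : ℕ), lowRank g l π y ≤ l := fun _ => lowRank_le l π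
  have hle := slotLabel_le (sp := DenSpecial g l π) (ρ := lowRank g l π)
    (Nat.le_of_lt_succ l.2) hρ (Nat.le_of_lt_succ x.2)
  rcases le_or_gt x l with hx | hx
  · have hx' : (x : ℕ) ≤ l := hx
    have h1 := highExc_denInsert π hg (le_refl l)
    have h2 := excedance_denInsert_self (L := l) π hg l.2
    have h3 : ∀ j ∈ Ico ((l : ℕ) + 1) (N + 1),
        (if j + g ≤ word (denInsert g l π l * Equiv.swap x l) j then 1 else 0)
          = if j + g ≤ word (denInsert g l π l) j then 1 else 0 := fun j hj => by
      have := (mem_Ico.1 hj).1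
      rw [word_mul_swap, Equiv.swap_apply_of_ne_of_ne (by omega) (by omega)]
    have h4 := le_iff_card_le_card_cycBetween (w := word (denInsert g l π l))
      (T := threshold g l l) (mem_range.2 (by omega : (x : ℕ) < l + 1))
    rw [← lowRank] at h4
    rw [highExc, sum_eq_sum_Ico_succ_bot l.2, if_congr h2 rfl rfl, ite_not] at h1
    rw [denExtend_of_ge π hx, highExc, sum_eq_sum_Ico_succ_bot l.2, sum_congr rfl h3,
      word_mul_swap, Equiv.swap_apply_right, Nat.add_left_cancel (h1.trans (add_comm _ _)), add_comm]
    congr 1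
    refine if_congr ?_ rfl rfl
    rw [slotLabel, if_pos hx'] at hle ⊢
    rw [threshold_of_le le_rfl] at h4
    have := hρ x hx'
    -- If `N < g + l`, neither an excedance at `l` nor so large a label can occur.
    rcases lt_or_ge N (g + l) with hN | hN
    · have := word_lt (denInsert g l π l) x.2
      omega
    · have h5 := countFrom_denSpecial π hg hN
      have h6 := card_low π hg hN
      rw [threshold_of_le le_rfl] at h6
      omega
  · have hx' : (l : ℕ) < x := hx
    rw [denExtend_of_le π hx.le, highExc_denInsert π hg hx.le,
      if_congr (inChain_min_iff π hg (by omega)) rfl rfl]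
    congr 1
    by_cases hs : DenSpecial g l π (x - 1)
    · have := slotLabel_lt_of_special (ρ := lowRank g l π) hx' (Nat.le_of_lt_succ x.2) hs
      rw [if_pos hs, if_neg]
      rcases lt_or_ge N (g + l) with hN | hN
      · omega
      · have h5 := countFrom_denSpecial π hg hN
        have h6 := card_low π hg hN
        omega
    · have := lt_slotLabel_of_not_special (ρ := lowRank g l π) hx' (Nat.le_of_lt_succ x.2) hs
      rw [if_neg hs, if_pos]
      have hN : g + l ≤ N := by
        by_contra h
        exact hs (Or.inr (by omega))
      have h5 := countFrom_denSpecial π hg hN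
      have h6 := card_low π hg hN
      have h7 : #{i ∈ range ((l : ℕ) + 1) | word (denInsert g l π l) i < threshold g l l} ≤ l + 1 :=
        (card_filter_le _ _).trans (card_range _).le
      omega

end stats

/-! ### Injectivity of the extension -/

section injective

/-- Place `j` carries the smallest excedance letter that is at least `min (j + g - 1) N`, or an
even smaller one that is not an excedance letter. -/
def Marked (g L : ℕ) {N : ℕ} (σ : Equiv.Perm (Fin (N + 1))) (j : ℕ) : Prop :=
  min (j + g - 1) N ≤ word σ j ∧ ∀ i ≤ N, max i L + g ≤ word σ i →
    min (j + g - 1) N ≤ word σ i → word σ j ≤ word σ i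

/-- The letter `t` of `σ` has been raised when inserting at `z`. -/
def Raised (g L : ℕ) {N : ℕ} (σ : Equiv.Perm (Fin (N + 1))) (z t : ℕ) : Prop :=
  min (z + g - 1) N ≤ t ∧ ∃ i ≤ N, word σ i = t ∧ min (max i L + g - 1) N ≤ t

variable {g N : ℕ} {l : Fin (N + 1)}

lemma max_swap {a l i : ℕ} (h : a ≤ l) : max (Equiv.swap a l i) l = max i l := by
  rw [Equiv.swap_apply_def]
  split_ifs <;> omega

lemma swap_le {a l i N : ℕ} (h : a ≤ l) (hl : l ≤ N) (hi : i ≤ N) : Equiv.swap a l i ≤ N := by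
  rw [Equiv.swap_apply_def]
  split_ifs <;> omega

/-- Carrier places enter the minimality condition only through `max i l`, which is unchanged by an
exchange of `a ≤ l` with `l`. -/
lemma Marked.mul_swap {σ : Equiv.Perm (Fin (N + 1))} {j : ℕ} (hj : (l : ℕ) < j)
    {a : Fin (N + 1)} (ha : a ≤ l) (h : Marked g l σ j) : Marked g l (σ * Equiv.swap a l) j := by
  have ha' : (a : ℕ) ≤ l := ha
  rw [Marked, word_mul_swap, Equiv.swap_apply_of_ne_of_ne (by omega) (by omega)]
  refine ⟨h.1, fun i hi => ?_⟩
  rw [word_mul_swap, ← max_swap ha']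
  exact h.2 _ (swap_le ha' (Nat.le_of_lt_succ l.2) hi)

lemma Raised.mul_swap {σ : Equiv.Perm (Fin (N + 1))} {z t : ℕ}
    {a : Fin (N + 1)} (ha : a ≤ l) (h : Raised g l σ z t) :
    Raised g l (σ * Equiv.swap a l) z t := by
  have ha' : (a : ℕ) ≤ l := ha
  obtain ⟨h1, i, hi, rfl, h2⟩ := h
  refine ⟨h1, Equiv.swap (a : ℕ) l i, swap_le ha' (Nat.le_of_lt_succ l.2) hi, ?_, ?_⟩
  · rw [word_mul_swap, Equiv.swap_apply_self]
  · rwa [max_swap ha']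

lemma marked_mul_swap {σ : Equiv.Perm (Fin (N + 1))} {j : ℕ} (hj : (l : ℕ) < j)
    {a : Fin (N + 1)} (ha : a ≤ l) : Marked g l (σ * Equiv.swap a l) j ↔ Marked g l σ j := by
  refine ⟨fun h => ?_, Marked.mul_swap hj ha⟩
  simpa [mul_assoc] using h.mul_swap hj ha

lemma raised_mul_swap {σ : Equiv.Perm (Fin (N + 1))} {z t : ℕ} {a : Fin (N + 1)} (ha : a ≤ l) :
    Raised g l (σ * Equiv.swap a l) z t ↔ Raised g l σ z t := by
  refine ⟨fun h => ?_, Raised.mul_swap ha⟩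
  simpa [mul_assoc] using h.mul_swap ha

variable {π : Equiv.Perm (Fin N)} {z : ℕ}

lemma exists_word_eq_raise {t : ℕ} (ht : t < N + 1) :
    t = word (raise g l π z) N ∨ ∃ i < N, t = word (raise g l π z) (word π i) := by
  obtain ⟨u, hu⟩ := (raise g l π z).surjective ⟨t, ht⟩
  have hu' : word (raise g l π z) u = t := by rw [word_val, hu]
  rcases lt_or_ge (u : ℕ) N with h | h
  · obtain ⟨i, hi⟩ := π.surjective ⟨u, h⟩
    refine Or.inr ⟨i, i.2, ?_⟩
    rw [word_val, hi, ← hu']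
  · left
    rw [← hu', show (u : ℕ) = N by omega]

lemma word_denInsert_cases (hz : z < N + 1) {i : ℕ} (hi : i ≤ N) :
    (i = z ∧ word (denInsert g l π ⟨z, hz⟩) i = word (raise g l π z) N) ∨
    (∃ k < N, (k = i ∧ i < z ∨ k + 1 = i ∧ z ≤ k) ∧
      word (denInsert g l π ⟨z, hz⟩) i = word (raise g l π z) (word π k)) := by
  rcases lt_trichotomy i z with h | h | h
  · exact Or.inr ⟨i, by omega, Or.inl ⟨rfl, h⟩, word_denInsert_of_lt hz h⟩
  · subst h
    exact Or.inl ⟨rfl, word_denInsert_self hz⟩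
  · obtain ⟨k, rfl⟩ : ∃ k, i = k + 1 := ⟨i - 1, by omega⟩
    exact Or.inr ⟨k, by omega, Or.inr ⟨rfl, by omega⟩, word_denInsert_succ hz (by omega) (by omega)⟩

lemma exists_place {k : ℕ} (hz : z < N + 1) (hk : k < N) :
    ∃ i ≤ N, (k = i ∧ i < z ∨ k + 1 = i ∧ z ≤ k) ∧
      word (denInsert g l π ⟨z, hz⟩) i = word (raise g l π z) (word π k) := by
  rcases lt_or_ge k z with h | h
  · exact ⟨k, hk.le, Or.inl ⟨rfl, h⟩, word_denInsert_of_lt hz h⟩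
  · exact ⟨k + 1, hk, Or.inr ⟨rfl, h⟩, word_denInsert_succ hz h hk⟩

lemma marked_denInsert (hz : z < N + 1) :
    Marked g l (denInsert g l π ⟨z, hz⟩) z := by
  rw [Marked, word_denInsert_self]
  refine ⟨inChain_self.word_raise.1, fun i hi h1 h2 => ?_⟩
  rcases word_denInsert_cases (g := g) (l := l) (π := π) hz hi with ⟨_, h⟩ | ⟨k, hk, hik, h⟩
  · exact h.ge
  · rw [h] at h1 h2 ⊢
    by_cases hC : InChain g l π z (word π k)
    · exact hC.word_raise.top_le
    · rw [word_raise_of_not hC] at h1 h2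
      rw [InChain, topLetter_word hk] at hC
      omega

/-- A raised letter after `z` leaves its old value at another place, where it is a smaller excedance
letter violating minimality. An unraised one is below `min (j + g - 1) N`. -/
lemma not_marked_denInsert (hg : 1 ≤ g) (hz : z < N + 1) (hlz : (l : ℕ) ≤ z) {j : ℕ} (hj : z < j)
    (hjN : j ≤ N) : ¬ Marked g l (denInsert g l π ⟨z, hz⟩) j := by
  rintro ⟨h1, h2⟩
  obtain ⟨k, rfl⟩ : ∃ k, j = k + 1 := ⟨j - 1, by omega⟩
  rw [word_denInsert_succ hz (by omega) (by omega)] at h1 h2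
  have hk := word_lt π (by omega : k < N)
  have hCk := inChain_word_iff (x := z) π hg (by omega : (l : ℕ) ≤ k) (by omega) (by omega)
  by_cases hC : InChain g l π z (word π k)
  · have h3 := hCk.1 hC
    have h4 := (hC.lt_word_raise inChain_self hk).1
    obtain ⟨i, hi, hw, hi'⟩ : ∃ i ≤ N, word (denInsert g l π ⟨z, hz⟩) i = word π k ∧
        max i l + g ≤ word π k := by
      rcases exists_word_eq_raise (g := g) (l := l) (π := π) (z := z) (Nat.lt_succ_of_lt hk)
        with h | ⟨m, hm, h⟩
      · exact ⟨z, by omega, by rw [word_denInsert_self, ← h], by omega⟩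
      · obtain ⟨i, hi, him, hw⟩ := exists_place (g := g) (l := l) (π := π) hz hm
        refine ⟨i, hi, by rw [hw, ← h], ?_⟩
        have hCm : InChain g l π z (word π m) := by
          by_contra hCm
          rw [word_raise_of_not hCm] at h
          exact hCm (h ▸ hC)
        have h5 := (hCm.lt_word_raise inChain_self (word_lt π hm)).1
        have h6 := (topLetter_word hm).1 (hCm.2.resolve_left (word_lt π hm).ne)
        omega
    have := h2 i hi (by rw [hw]; exact hi') (by rw [hw]; omega)
    omega
  · have := mt hCk.2 hC
    rw [word_raise_of_not hC] at h1
    omega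

/-- The chain is permuted within itself, so it can be read off the result: top letters move strictly
up, which turns the bound for a top letter into the one in `Raised`, even after a shift of the
place. -/
lemma inChain_iff_raised (hg : 1 ≤ g) (hz : z < N + 1) (hlz : (l : ℕ) ≤ z) {t : ℕ}
    (ht : t < N + 1) :
    InChain g l π z t ↔ Raised g l (denInsert g l π ⟨z, hz⟩) z t := by
  constructor
  · intro hC
    refine ⟨hC.1, ?_⟩
    rcases exists_word_eq_raise (g := g) (l := l) (π := π) (z := z) ht with h | ⟨m, hm, h⟩
    · refine ⟨z, by omega, by rw [word_denInsert_self, ← h], ?_⟩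
      have := hC.1
      omega
    · obtain ⟨i, hi, him, hw⟩ := exists_place (g := g) (l := l) (π := π) hz hm
      refine ⟨i, hi, by rw [hw, ← h], ?_⟩
      have hCm : InChain g l π z (word π m) := by
        by_contra hCm
        rw [word_raise_of_not hCm] at h
        exact hCm (h ▸ hC)
      have h5 := (hCm.lt_word_raise inChain_self (word_lt π hm)).1
      have h6 := (topLetter_word hm).1 (hCm.2.resolve_left (word_lt π hm).ne)
      omega
  · rintro ⟨h1, i, hi, hw, h2⟩
    rcases word_denInsert_cases (g := g) (l := l) (π := π) hz hi with ⟨_, h⟩ | ⟨k, hk, hik, h⟩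
    · rw [← hw, h]
      exact inChain_self.word_raise
    · rw [h] at hw
      by_contra hC
      have hCk : ¬ InChain g l π z (word π k) := by
        intro hCk
        rw [← hw] at hC
        exact hC hCk.word_raise
      rw [word_raise_of_not hCk] at hw
      rw [← hw] at h1 h2
      have := word_lt π hk
      rw [InChain, topLetter_word hk] at hCk
      omega

lemma denExtend_injective (hg : 1 ≤ g) : Function.Injective (denExtend g l) := by
  rintro ⟨π, x⟩ ⟨ρ, y⟩ h
  have hz : max x l = max y l := by
    -- The larger insertion place would exceed `l` and be marked in one image but not in the other.
    wlog hlt : max x l < max y l generalizing π ρ x y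
    · rcases lt_or_eq_of_le (not_lt.1 hlt) with h' | h'
      · exact (this ρ y π x h.symm h').symm
      · exact h'.symm
    exfalso
    have hlt' : ((max x l : Fin (N + 1)) : ℕ) < (max y l : Fin (N + 1)) := hlt
    have hx : (l : ℕ) ≤ (max x l : Fin (N + 1)) := le_max_right x l
    have h1 := not_marked_denInsert (π := π) hg (max x l).2 hx hlt' (Nat.le_of_lt_succ (max y l).2)
    have h2 := marked_denInsert (g := g) (l := l) (π := ρ) (max y l).2
    apply h1
    rw [← marked_mul_swap (by omega) (min_le_right y l)] at h2
    rw [← marked_mul_swap (by omega) (min_le_right x l)]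
    exact (congrArg (fun σ => Marked g l σ (max y l : Fin (N + 1))) h).mpr h2
  rw [denExtend, denExtend] at h
  simp only at h
  rw [← hz] at h
  have hlz : (l : ℕ) ≤ (max x l : Fin (N + 1)) := le_max_right x l
  have hraise : raise g l π (max x l : Fin (N + 1)) = raise g l ρ (max x l : Fin (N + 1)) := by
    rw [raise, raise]
    congr 1
    ext t
    simp only [mem_filter, mem_univ, true_and]
    rw [inChain_iff_raised hg (max x l).2 hlz t.2, inChain_iff_raised hg (max x l).2 hlz t.2,
      ← raised_mul_swap (min_le_right x l),
      ← raised_mul_swap (σ := denInsert g l ρ _) (min_le_right y l)]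
    exact iff_of_eq (congrArg (fun σ => Raised g l σ _ _) h)
  rw [denInsert, denInsert, hraise, mul_assoc, mul_assoc] at h
  replace h := mul_left_cancel h
  -- Once the raising is cancelled, the largest letter stands at `min x l` if the insertion was at
  -- `l`; beyond `l` both minima equal `l`.
  have hmin : min x l = min y l := by
    rcases le_total x l with hx | hx
    · rw [max_eq_right hx] at h hz
      have hy : y ≤ l := by
        rw [hz]
        exact le_max_left _ _
      rw [min_eq_left hx, min_eq_left hy] at h ⊢
      have h1 : (insertTop π l * Equiv.swap x l) x = Fin.last N := by simp
      rw [h] at h1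
      have h2 : (insertTop ρ l * Equiv.swap y l) y = Fin.last N := by simp
      exact (insertTop ρ l * Equiv.swap y l).injective (h1.trans h2.symm)
    · rw [max_eq_left hx] at hz
      rw [min_eq_right hx]
      rcases le_total y l with hy | hy
      · rw [max_eq_right hy] at hz
        rw [max_eq_left hx] at h
        subst hz
        rw [min_self, min_eq_left hy] at h
        have h1 : (insertTop π x * Equiv.swap x x) x = Fin.last N := by simp
        rw [h] at h1
        have h2 : (insertTop ρ x * Equiv.swap y x) y = Fin.last N := by simp
        rw [min_eq_left hy]
        exact (insertTop ρ x * Equiv.swap y x).injective (h1.trans h2.symm)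
      · rw [min_eq_right hy]
  rw [hmin] at h
  have hπ := insertTop_left_injective _ (mul_right_cancel h)
  have hx : (x : ℕ) = y := by
    have h1 := congrArg Fin.val hz
    have h2 := congrArg Fin.val hmin
    simp only [Fin.coe_max, Fin.coe_min] at h1 h2
    omega
  rw [hπ, Fin.ext hx]

end injective

/-! ### Comparing the two recursions -/

section recursion

variable {R : Type*} [AddCommMonoid R]

lemma lowRank_injOn {g N : ℕ} (l : Fin (N + 1)) (π : Equiv.Perm (Fin N)) {x y : ℕ} (hx : x ≤ l)
    (hy : y ≤ l) (h : lowRank g l π x = lowRank g l π y) : x = y :=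
  card_cycBetween_injOn (word_injective _).injOn (mem_range.2 (by omega : x < l + 1))
    (mem_range.2 (by omega : y < l + 1)) h

lemma sum_highExc_highCost_succ {g L N : ℕ} (hg : 1 ≤ g) (hL : L ≤ N) (f : ℕ → ℕ → R) :
    ∑ σ : Equiv.Perm (Fin (N + 1)), f (highExc g L σ) (highCost g L σ)
      = ∑ π : Equiv.Perm (Fin N), insertionOp (g + L) (N + 1) f (highExc g L π) (highCost g L π) := by
  obtain ⟨l, rfl⟩ : ∃ l : Fin (N + 1), (l : ℕ) = L := ⟨⟨L, by omega⟩, rfl⟩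
  exact sum_perm_eq_insertionOp _ _ _ _ (denExtend g l) (denExtend_injective hg)
    (fun π x => slotLabel N l (DenSpecial g l π) (lowRank g l π) x)
    (fun π x y h => Fin.ext <| slotLabel_injOn (fun _ => lowRank_le l π)
      (fun _ hx _ hy => lowRank_injOn l π hx hy) (by omega) (by omega) h)
    (fun π x => slotLabel_le hL (fun _ => lowRank_le l π) (by omega))
    (fun π x => highCost_denExtend π hg x) (fun π x => highExc_denExtend π hg x) f

/-- All labels in these insertions are below `r`, so the first statistic stays `0` and the labels
are summed freely. -/
lemma sum_rdes_rmaj_of_le {r : ℕ} (hr : 1 ≤ r) {n : ℕ} (hn : n ≤ r) (f : ℕ → ℕ → R) :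
    ∑ π : Equiv.Perm (Fin n), f (rdes r π) (rmaj r π) = fillOp (f 0) n 0 := by
  induction n generalizing f with
  | zero => simp [rdes, rmaj, rDes, rInv, invSet, fillOp]
  | succ n ih =>
    rw [sum_rdes_rmaj_succ hr]
    have h := ih (by omega) (fun k d => ∑ c ∈ range (n + 1), f k (d + c))
    rw [fillOp_sum] at h
    simp only [fillOp_add] at h
    refine Eq.trans ?_ h
    refine sum_congr rfl fun π _ => sum_congr rfl fun c hc => ?_
    have := mem_range.1 hc
    rw [if_neg (by omega), add_zero]

lemma fillOp_insertionOp (r N m : ℕ) (f : ℕ → ℕ → R) (k d : ℕ) :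
    insertionOp r N (fun k => fillOp (f k) m) k d = fillOp (insertionOp r N f k) m d := by
  rw [show insertionOp r N f k = fun d => insertionOp r N f k d from rfl]
  simp only [insertionOp]
  rw [fillOp_sum]
  exact sum_congr rfl fun c _ => (fillOp_add _ _ _ _).symm

lemma sum_fillOp_highExc {g L : ℕ} (hg : 1 ≤ g) {n : ℕ} (hn : L ≤ n) (f : ℕ → ℕ → R) :
    ∑ π : Equiv.Perm (Fin n), fillOp (f (highExc g L π)) L (highCost g L π)
      = L.factorial • ∑ π : Equiv.Perm (Fin n), f (rdes (g + L) π) (rmaj (g + L) π) := by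
  induction n, hn using Nat.le_induction generalizing f with
  | base =>
    rw [sum_rdes_rmaj_of_le (by omega) (by omega)]
    simp [highExc, highCost, Fintype.card_perm]
  | succ n hn ih =>
    rw [sum_rdes_rmaj_succ (by omega), ← ih,
      sum_highExc_highCost_succ hg hn fun k => fillOp (f k) L]
    exact sum_congr rfl fun π _ => fillOp_insertionOp _ _ _ _ _ _

lemma highExc_mul_swap {g L n : ℕ} (π : Equiv.Perm (Fin n)) {a b : Fin n} (ha : (a : ℕ) < L)
    (hb : (b : ℕ) < L) : highExc g L (π * Equiv.swap a b) = highExc g L π := by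
  refine sum_congr rfl fun j hj => ?_
  have := (mem_Ico.1 hj).1
  rw [word_mul_swap, Equiv.swap_apply_of_ne_of_ne (by omega) (by omega)]

lemma highCost_mul_swap {g L n : ℕ} (π : Equiv.Perm (Fin n)) {a b : Fin n} (ha : (a : ℕ) < L)
    (hb : (b : ℕ) < L) : highCost g L (π * Equiv.swap a b) = highCost g L π := by
  refine sum_congr rfl fun j hj => ?_
  have := (mem_Ico.1 hj).1
  exact cost_mul_swap_of_lt _ _ (by omega) (by omega)

/-- For `L ≤ n` the low costs are averaged out with the high statistics as parameters. For `n ≤ L`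
there are no high places and both sides reduce to `fillOp`. -/
lemma factorial_smul_sum_gexc_gden {g L : ℕ} (hg : 1 ≤ g) (n : ℕ) (f : ℕ → ℕ → R) :
    (min L n).factorial • ∑ π : Equiv.Perm (Fin n), f (gexc g (L + 1) π) (gden g (L + 1) π)
      = (min L n).factorial •
        ∑ π : Equiv.Perm (Fin n), f (rdes (g + L) π) (rmaj (g + L) π) := by
  simp only [gexc_eq_highExc, gden_eq_sum_cost]
  rcases le_total L n with h | h
  · rw [min_eq_left h, ← sum_fillOp_highExc hg h]
    have h1 := factorial_smul_sum_perm (threshold g L) h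
      (fun (π : Equiv.Perm (Fin n)) d => f (highExc g L π) (d + highCost g L π)) (by
        intro π a b ha hb
        rw [highExc_mul_swap π ha hb, highCost_mul_swap π ha hb])
    simp only [fillOp_add, zero_add] at h1
    rw [← h1]
    congr 1
    refine sum_congr rfl fun π _ => ?_
    rw [highCost, range_eq_Ico, range_eq_Ico, sum_Ico_consecutive _ (Nat.zero_le L) h]
  · rw [min_eq_right h, sum_rdes_rmaj_of_le (by omega) (by omega)]
    have h1 := factorial_smul_sum_perm (threshold g L) le_rfl
      (fun (_ : Equiv.Perm (Fin n)) d => f 0 d) (fun _ _ _ _ _ => rfl)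
    simp only [highExc, Ico_eq_empty_of_le h, sum_empty]
    rw [h1]
    simp [Fintype.card_perm]

end recursion

theorem mainTheorem1 (g ℓ : ℕ) (hg : 1 ≤ g) (hℓ : 1 ≤ ℓ) :
    IsEulerMahonian (g + ℓ - 1) (gexc g ℓ) (gden g ℓ) := by
  obtain ⟨L, rfl⟩ : ∃ L, ℓ = L + 1 := ⟨ℓ - 1, by omega⟩
  intro n
  have h := factorial_smul_sum_gexc_gden (L := L) hg n
    fun k d => (MvPolynomial.X 0 ^ k * MvPolynomial.X 1 ^ d : MvPolynomial (Fin 2) ℤ)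
  rw [nsmul_eq_mul, nsmul_eq_mul] at h
  -- Integer polynomials form a domain of characteristic zero, so the factorial can be cancelled.
  exact mul_left_cancel₀ (Nat.cast_ne_zero.2 (Nat.factorial_ne_zero _)) h
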